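/- **Setting.** Let $\mathcal H=(\mathbb C^C)^{\otimes n}\otimes(\mathbb C^Q)^{\otimes n}=\mathcal H_C\otimes\mathcal H_Q$ (clock and quantum register of an open chain of $n$ sites). A *standard-form Hamiltonian* is $H=H_{trans}+H_{pen}+H_{in}+H_{out}$, each term being $\sum_{i=1}^{n-1}h^{(i,i+1)}$ for a fixed two-site operator $h$, where - $h_{trans}=\sum \tfrac12(|cd\rangle\otimes U_{abcd}-|ab\rangle)(\langle cd|\otimes U_{abcd}^\dagger-\langle ab|)$, summed over a set of transition rules $ab\to cd$ between pairs of clock basis symbols, with unitaries $U_{abcd}$ on $(\mathbb C^Q)^{\otimes2}$; - $h_{pen}=\sum_{ab\text{ illegal}}|ab\rangle\langle ab|\otimes\mathbb 1$ for a set of illegal pairs; a clock basis state is *legal* if it contains no illegal pair; - $h_{in}=\sum_{ab}|ab\rangle\langle ab|\otimes\Pi_{ab}$ and $h_{out}=|xy\rangle\langle xy|\otimes\Pi_{xy}$ with $\Pi_{ab},\Pi_{xy}$ projectors onto spans of standard basis states. Transition rules act on clock basis states by $ab\to cd$ on neighbouring sites. An *evolution* of length $m$ is a sequence of distinct legal clock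 basis states $|0\rangle\to|1\rangle\to\dots\to|m-1\rangle$ following the rules, such that no backwards transition applies to $|0\rangle$ and no forwards transition to $|m-1\rangle$; $U_t$ denotes the register unitary of $|t\rangle\to|t+1\rangle$. The clock is a *standard-form clock* with runtime $T=T(n)$ and initialisation time $T_{init}=T_{init}(n)$, $0\le T_{init}<T$, if: - some set of clock basis states contains all legal ones, is closed under the rules in both directions, and to each of its states at most one rule, at one place, applies in each direction; - every minimal set of clock states closed under the rules (in both directions) that contains only legal states has a state without a backwards and a state without a forwards transition; there is an evolution of length $T$ (so $T$ is the number of clock states of this evolution); - along every evolution: $U_t=\mathbb 1$ for $t<T_{init}$; whether $t\le T_{init}$ is detected by the presence of a nearest-neighbour pair from a fixed set; $H_{in}$ acts only on states $|t\rangle$ with $t<T_{init}$; and the pair $xy$ of $h_{out}$ occurs in the last state, at exactly one place, and in no other state; - a legal clock state whose minimal closed set contains an illegal state reaches an illegal state within $R(n)$ transitions (forwards or backwards); - $T(n)=\Omega(n^2)$, $T_{init}(n)=O(n)$ and $R(n)=O(n)$. Let $\eta\ge0$ and $s\ge 0$ with $s<1-\eta$. A *QMA verifier* for a promise problem $(A_{YES},A_{NO})$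 is a quantum Turing machine $M$ with polynomials $p,q$ such that on each instance $x$ and each quantum witness of at most $q(|x|)$ qubits $M$ halts within $p(|x|)$ steps; if $x\in A_{YES}$, then some witness is rejected with probability at most $\eta$; if $x\in A_{NO}$, then every witness is accepted with probability at most $s$. $H$ *encodes the verification of $x$* if, for some evolution of length $T$ and with $U=U_{T-2}\cdots U_1U_0$ and $\Pi_{out}$ the operator with which $H_{out}$ acts on the register at the last clock state: for each $k\le q(|x|)$ there is a linear isometry $E$ from $k$-qubit states into the *correctly initialised* register states (those $|\varphi\rangle$ with $H_{in}|t\rangle|\varphi\rangle=0$ for all $t<T$) such that, for every unit $|w\rangle$, the rejection probability $\langle Ew|U^\dagger\Pi_{out}U|Ew\rangle$ equals the probability that $M$ rejects $(x,|w\rangle)$; and no correctly initialised unit register state has a rejection probability below the infimum over all witnesses. **Theorem (Constant Acceptance Upper Bound).** Let functions $T,T_{init},R$ as above be given. There is a constant $K$, depending only on these functions, such that for all $\eta,s$ as above (in particular for every constant maximal rejection probability $\eta$ on YES instances), every QMA verifier with these parameters, every YES instance $x$, every $n$ and every standard-form Hamiltonian $H$ on $n$ sites with a standard-form clock that encodes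 the verification of $x$, the smallest eigenvalue $\lambda_0(H)$ satisfies $$0\le\lambda_0(H)\le\eta\left(1-\cos\frac{\pi}{2(T(n)-T_{init}(n))+1}\right)\le K\,\frac{\eta}{T(n)^2}.$$ -/

import Mathlib

open Asymptotics Filter

noncomputable section

/-! ### Quantum Turing machines and QMA -/

/-- A quantum Turing machine with one two-way infinite tape. The tape alphabet is
`Fin (extra + 3)`: `0` is the blank, `1` and `2` stand for the bits `0` and `1`. The amplitude
`δ q a b q' d` is that of the move "in state `q`, reading `a`: write `b`, enter `q'`, move the head
right if `d` is true and left otherwise". -/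
structure QTM where
  extra : ℕ
  states : ℕ
  start : Fin states
  accept : Fin states
  reject : Fin states
  accept_ne_reject : accept ≠ reject
  δ : Fin states → Fin (extra + 3) → Fin (extra + 3) → Fin states → Bool → ℂ

namespace QTM

/-- A configuration: internal state, tape content (finitely many non-blank cells), head position. -/
structure Config (M : QTM) where
  state : Fin M.states
  tape : ℤ →₀ Fin (M.extra + 3)
  head : ℤ

/-- Finite superpositions of configurations. -/
abbrev Superposition (M : QTM) := M.Config →₀ ℂ

/-- The squared Euclidean length of a superposition. -/
def normSq {M : QTM} (ψ : M.Superposition) : ℝ := ψ.sum fun _ a => ‖a‖ ^ 2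

/-- One step from a single configuration. -/
def stepConfig (M : QTM) (c : M.Config) : M.Superposition :=
  ∑ b : Fin (M.extra + 3), ∑ q' : Fin M.states, ∑ d : Bool,
    Finsupp.single
      (⟨q', c.tape.update c.head b, if d then c.head + 1 else c.head - 1⟩ : M.Config)
      (M.δ c.state (c.tape c.head) b q' d)

/-- The time evolution operator: the linear extension of `stepConfig`. -/
def evolve (M : QTM) : M.Superposition →ₗ[ℂ] M.Superposition :=
  Finsupp.linearCombination ℂ M.stepConfig

/-- The machine is well formed if its time evolution preserves Euclidean length. -/
def WellFormed (M : QTM) : Prop := ∀ ψ : M.Superposition, normSq (M.evolve ψ) = normSq ψ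

/-- The superposition after `τ` steps. -/
def after (M : QTM) (τ : ℕ) (ψ : M.Superposition) : M.Superposition := (M.evolve)^[τ] ψ

def Config.Halted {M : QTM} (c : M.Config) : Prop := c.state = M.accept ∨ c.state = M.reject

/-- The machine halts at time `τ`: all configurations are then halted, and none was before. -/
def HaltsAt (M : QTM) (ψ : M.Superposition) (τ : ℕ) : Prop :=
  (∀ c ∈ (M.after τ ψ).support, c.Halted) ∧
    ∀ τ' < τ, ∀ c ∈ (M.after τ' ψ).support, ¬ c.Halted

/-- The weight of a superposition on the configurations in internal state `q`. -/
def weight {M : QTM} (q : Fin M.states) (ψ : M.Superposition) : ℝ :=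
  ψ.sum fun c a => if c.state = q then ‖a‖ ^ 2 else 0

def bitSymbol (M : QTM) (b : Bool) : Fin (M.extra + 3) :=
  if b then ⟨2, by omega⟩ else ⟨1, by omega⟩

/-- The tape holding a word on the cells `0, 1, 2, …`, and blanks elsewhere. -/
def wordTape (M : QTM) (u : List (Fin (M.extra + 3))) : ℤ →₀ Fin (M.extra + 3) :=
  Finsupp.ofSupportFinite (fun z : ℤ => if 0 ≤ z then u.getD z.toNat 0 else 0) <| by
    refine (Set.finite_Ico (0 : ℤ) (u.length : ℤ)).subset ?_
    intro z hz
    simp only [Function.mem_support, ne_eq, ite_eq_right_iff, not_forall] at hz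
    obtain ⟨h0, h1⟩ := hz
    refine ⟨h0, ?_⟩
    by_contra hlt
    exact h1 (List.getD_eq_default _ _ (by omega))

/-- The initial configuration on input `(x, y)`: the string `x`, a blank, the string `y`. -/
def inputConfig (M : QTM) (x y : List Bool) : M.Config :=
  ⟨M.start, M.wordTape (x.map M.bitSymbol ++ 0 :: y.map M.bitSymbol), 0⟩

/-- The initial superposition on input `(x, |w⟩)`, where `|w⟩` is a state of `k` qubits. -/
def input (M : QTM) (x : List Bool) {k : ℕ} (w : EuclideanSpace ℂ (Fin k → Bool)) :
    M.Superposition :=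
  ∑ y : Fin k → Bool, Finsupp.single (M.inputConfig x (List.ofFn y)) (w y)

/-- On input `(x, |w⟩)` the machine halts and accepts with probability `r`. -/
def AcceptsWithProb (M : QTM) (x : List Bool) {k : ℕ} (w : EuclideanSpace ℂ (Fin k → Bool))
    (r : ℝ) : Prop :=
  ∃ τ, M.HaltsAt (M.input x w) τ ∧ weight M.accept (M.after τ (M.input x w)) = r

/-- On input `(x, |w⟩)` the machine halts and rejects with probability `r`. -/
def RejectsWithProb (M : QTM) (x : List Bool) {k : ℕ} (w : EuclideanSpace ℂ (Fin k → Bool))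
    (r : ℝ) : Prop :=
  ∃ τ, M.HaltsAt (M.input x w) τ ∧ weight M.reject (M.after τ (M.input x w)) = r

end QTM

structure PromiseProblem where
  yes : Set (List Bool)
  no : Set (List Bool)
  disjoint : Disjoint yes no

/-- `M` is a QMA verifier for `A` with running time `p`, witnesses of at most `q` qubits, maximal
rejection probability `η` on YES instances and maximal acceptance probability `s` on NO instances
(the usual choice is `η = s = 1/3`). -/
structure IsQMAVerifier (A : PromiseProblem) (M : QTM) (p q : Polynomial ℕ) (η s : ℝ) : Prop where
  wellFormed : M.WellFormed
  halts : ∀ x ∈ A.yes ∪ A.no, ∀ k ≤ q.eval x.length, ∀ w : EuclideanSpace ℂ (Fin k → Bool),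
    ‖w‖ = 1 → ∃ τ ≤ p.eval x.length, M.HaltsAt (M.input x w) τ
  complete : ∀ x ∈ A.yes, ∃ k ≤ q.eval x.length, ∃ w : EuclideanSpace ℂ (Fin k → Bool),
    ‖w‖ = 1 ∧ ∃ r ≤ η, M.RejectsWithProb x w r
  sound : ∀ x ∈ A.no, ∀ k ≤ q.eval x.length, ∀ w : EuclideanSpace ℂ (Fin k → Bool),
    ‖w‖ = 1 → ∃ r ≤ s, M.AcceptsWithProb x w r

/-! ### Nearest-neighbour operators on a chain -/

/-- The left site of a bond of the open chain of `n` sites. -/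
def leftSite {n : ℕ} (b : Fin (n - 1)) : Fin n := ⟨b, by omega⟩

/-- The right site of a bond. -/
def rightSite {n : ℕ} (b : Fin (n - 1)) : Fin n := ⟨b + 1, by omega⟩

/-- The two symbols that a standard basis state carries on a bond. -/
def bondPair {n : ℕ} {α : Type} (c : Fin n → α) (b : Fin (n - 1)) : α × α :=
  (c (leftSite b), c (rightSite b))

/-- Two standard basis states agree on all sites off a bond. -/
def AgreeOff {n : ℕ} {α : Type} (b : Fin (n - 1)) (c c' : Fin n → α) : Prop :=
  ∀ j, j ≠ leftSite b → j ≠ rightSite b → c j = c' j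

/-- Labels of the standard basis of `ℋ_C ⊗ ℋ_Q = (ℂ^C)^{⊗ n} ⊗ (ℂ^Q)^{⊗ n}`. -/
abbrev ChainBasis (n C Q : ℕ) := (Fin n → Fin C) × (Fin n → Fin Q)

/-- Labels of the standard basis of `(ℂ^C)^{⊗ 2} ⊗ (ℂ^Q)^{⊗ 2}`. -/
abbrev PairBasis (C Q : ℕ) := (Fin C × Fin C) × (Fin Q × Fin Q)

open Classical in
/-- The two-site operator `h` acting on the bond `b` (identity elsewhere). -/
def atBond {n C Q : ℕ} (h : Matrix (PairBasis C Q) (PairBasis C Q) ℂ) (b : Fin (n - 1)) :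
    Matrix (ChainBasis n C Q) (ChainBasis n C Q) ℂ :=
  fun u v => if AgreeOff b u.1 v.1 ∧ AgreeOff b u.2 v.2 then
    h (bondPair u.1 b, bondPair u.2 b) (bondPair v.1 b, bondPair v.2 b) else 0

open Classical in
/-- A two-site operator on the quantum register acting on the bond `b`. -/
def registerAtBond {n Q : ℕ} (g : Matrix (Fin Q × Fin Q) (Fin Q × Fin Q) ℂ) (b : Fin (n - 1)) :
    Matrix (Fin n → Fin Q) (Fin n → Fin Q) ℂ :=
  fun s s' => if AgreeOff b s s' then g (bondPair s b) (bondPair s' b) else 0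

/-! ### Standard-form Hamiltonians -/

/-- The data of a standard-form Hamiltonian with clock dimension `C` and register dimension `Q`
per site: the transition rules `ab → cd` with their unitaries, the illegal pairs, for each clock
pair the register basis states penalised by `h_in`, and the one clock pair and the register basis
states penalised by `h_out`. -/
structure StandardForm (C Q : ℕ) where
  rules : Finset ((Fin C × Fin C) × (Fin C × Fin C))
  gate : Fin C × Fin C → Fin C × Fin C → Matrix.unitaryGroup (Fin Q × Fin Q) ℂ
  illegal : Finset (Fin C × Fin C)
  inPenalty : Fin C × Fin C → Finset (Fin Q × Fin Q)
  outPair : Fin C × Fin C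
  outPenalty : Finset (Fin Q × Fin Q)

namespace StandardForm

variable {C Q : ℕ}

/-- The operator `|cd⟩ ⊗ U - |ab⟩ ⊗ 1` from `(ℂ^Q)^{⊗ 2}` to `(ℂ^C)^{⊗ 2} ⊗ (ℂ^Q)^{⊗ 2}`. -/
def ruleVec (F : StandardForm C Q) (ab cd : Fin C × Fin C) :
    Matrix (PairBasis C Q) (Fin Q × Fin Q) ℂ :=
  fun u s => (if u.1 = cd then (F.gate ab cd : Matrix _ _ ℂ) u.2 s else 0) -
    (if u.1 = ab then (1 : Matrix (Fin Q × Fin Q) (Fin Q × Fin Q) ℂ) u.2 s else 0)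

/-- `h_trans = ∑ ½ (|cd⟩ ⊗ U - |ab⟩)(⟨cd| ⊗ U† - ⟨ab|)`, summed over the transition rules. -/
def hTrans (F : StandardForm C Q) : Matrix (PairBasis C Q) (PairBasis C Q) ℂ :=
  ∑ r ∈ F.rules, (1 / 2 : ℂ) • (F.ruleVec r.1 r.2 * (F.ruleVec r.1 r.2).conjTranspose)

/-- `h_pen = ∑ |ab⟩⟨ab| ⊗ 1`, summed over the illegal pairs. -/
def hPen (F : StandardForm C Q) : Matrix (PairBasis C Q) (PairBasis C Q) ℂ :=
  Matrix.diagonal fun u => if u.1 ∈ F.illegal then 1 else 0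

/-- `h_in = ∑ |ab⟩⟨ab| ⊗ Π_ab`. -/
def hIn (F : StandardForm C Q) : Matrix (PairBasis C Q) (PairBasis C Q) ℂ :=
  Matrix.diagonal fun u => if u.2 ∈ F.inPenalty u.1 then 1 else 0

/-- `h_out = |xy⟩⟨xy| ⊗ Π_xy`. -/
def hOut (F : StandardForm C Q) : Matrix (PairBasis C Q) (PairBasis C Q) ℂ :=
  Matrix.diagonal fun u => if u.1 = F.outPair ∧ u.2 ∈ F.outPenalty then 1 else 0

/-- `H_in` on the chain of `n` sites. -/
def chainIn (F : StandardForm C Q) (n : ℕ) :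
    Matrix (ChainBasis n C Q) (ChainBasis n C Q) ℂ := ∑ b : Fin (n - 1), atBond F.hIn b

/-- `H_out` on the chain of `n` sites. -/
def chainOut (F : StandardForm C Q) (n : ℕ) :
    Matrix (ChainBasis n C Q) (ChainBasis n C Q) ℂ := ∑ b : Fin (n - 1), atBond F.hOut b

/-- The standard-form Hamiltonian `H_trans + H_pen + H_in + H_out` on the chain of `n` sites. -/
def hamiltonian (F : StandardForm C Q) (n : ℕ) :
    Matrix (ChainBasis n C Q) (ChainBasis n C Q) ℂ :=
  (∑ b : Fin (n - 1), atBond F.hTrans b) + (∑ b : Fin (n - 1), atBond F.hPen b) +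
    F.chainIn n + F.chainOut n

/-! ### Clocks -/

/-- A clock basis state is legal if it contains no illegal pair. -/
def Legal (F : StandardForm C Q) {n : ℕ} (c : Fin n → Fin C) : Prop :=
  ∀ b : Fin (n - 1), bondPair c b ∉ F.illegal

/-- A transition rule, applied on the bond `b`, takes the clock state `c` to `c'`. -/
def BondStep (F : StandardForm C Q) {n : ℕ} (b : Fin (n - 1)) (c c' : Fin n → Fin C) : Prop :=
  (bondPair c b, bondPair c' b) ∈ F.rules ∧ AgreeOff b c c'

/-- Some transition rule takes the clock state `c` to `c'`. -/
def Step (F : StandardForm C Q) {n : ℕ} (c c' : Fin n → Fin C) : Prop :=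
  ∃ b, F.BondStep b c c'

/-- `c` and `c'` lie in the same minimal set of clock states closed under the transition rules. -/
def Connected (F : StandardForm C Q) {n : ℕ} (c c' : Fin n → Fin C) : Prop :=
  Relation.EqvGen F.Step c c'

open Classical in
/-- The register unitary that accompanies the transition from `c` to `c'` (where exactly one rule
on one bond realises that transition). -/
def stepGate (F : StandardForm C Q) {n : ℕ} (c c' : Fin n → Fin C) :
    Matrix (Fin n → Fin Q) (Fin n → Fin Q) ℂ :=
  ∑ b : Fin (n - 1), if F.BondStep b c c' then
    registerAtBond (F.gate (bondPair c b) (bondPair c' b) : Matrix _ _ ℂ) b else 0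

/-- `γ 0 → γ 1 → ⋯ → γ (m - 1)` is a complete evolution of the clock through `m` legal states, from
a state without a backwards transition to one without a forwards transition. (The values of `γ`
from `m` on play no role.) -/
structure IsEvolution (F : StandardForm C Q) {n : ℕ} (m : ℕ) (γ : ℕ → Fin n → Fin C) : Prop where
  pos : 0 < m
  injOn : Set.InjOn γ (Set.Iio m)
  legal : ∀ t < m, F.Legal (γ t)
  step : ∀ t, t + 1 < m → F.Step (γ t) (γ (t + 1))
  initial : ∀ c, ¬ F.Step c (γ 0)
  final : ∀ c, ¬ F.Step (γ (m - 1)) c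

/-- The clock of `F` on `n` sites is a standard-form clock with `T` time steps (clock states), of
which the first `Tinit` are used for the initialisation, and in which a legal state that is bound to
become illegal does so within `R` transitions. -/
structure IsStandardFormClock (F : StandardForm C Q) (n T Tinit R : ℕ) : Prop where
  /-- The set `W` of clock states: it contains all legal ones, is closed under the transition rules,
  and in each direction at most one rule, on one bond, applies to each of its states. -/
  wellFormed : ∃ W : Set (Fin n → Fin C),
    (∀ c, F.Legal c → c ∈ W) ∧
    (∀ c c', F.Step c c' → (c ∈ W ↔ c' ∈ W)) ∧
    (∀ c ∈ W, ∀ b₁ b₂ c₁ c₂, F.BondStep b₁ c c₁ → F.BondStep b₂ c c₂ → b₁ = b₂ ∧ c₁ = c₂) ∧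
    (∀ c ∈ W, ∀ b₁ b₂ c₁ c₂, F.BondStep b₁ c₁ c → F.BondStep b₂ c₂ c → b₁ = b₂ ∧ c₁ = c₂)
  /-- A class of legal states has a state without a backwards transition and one without a
  forwards transition. -/
  endpoints : ∀ c : Fin n → Fin C, (∀ c', F.Connected c c' → F.Legal c') →
    (∃ a, F.Connected c a ∧ ∀ c', ¬ F.Step c' a) ∧ (∃ z, F.Connected c z ∧ ∀ c', ¬ F.Step z c')
  /-- There is a valid evolution, and its runtime is `T`. -/
  runtime : ∃ γ : ℕ → Fin n → Fin C, F.IsEvolution T γ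
  /-- The initialisation ends before the last time step. -/
  init_lt : Tinit < T
  /-- The unitaries of the transitions `t → t + 1` with `t < Tinit` are trivial. -/
  init_trivial : ∀ m (γ : ℕ → Fin n → Fin C), F.IsEvolution m γ →
    ∀ t < Tinit, t + 1 < m → F.stepGate (γ t) (γ (t + 1)) = 1
  /-- Whether `t ≤ Tinit` can be detected by a 2-local, translationally invariant projector. -/
  init_detect : ∃ D : Set (Fin C × Fin C), ∀ m (γ : ℕ → Fin n → Fin C), F.IsEvolution m γ →
    ∀ t < m, (∃ b : Fin (n - 1), bondPair (γ t) b ∈ D) ↔ t ≤ Tinit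
  /-- `H_in` acts only on the time steps `t < Tinit` of a valid evolution. -/
  in_support : ∀ m (γ : ℕ → Fin n → Fin C), F.IsEvolution m γ →
    ∀ t < m, Tinit ≤ t → ∀ b : Fin (n - 1), F.inPenalty (bondPair (γ t) b) = ∅
  /-- The pair `xy` of `h_out` detects the last time step: it occurs there, on exactly one bond, and
  at no earlier time step. -/
  final_detect : ∀ m (γ : ℕ → Fin n → Fin C), F.IsEvolution m γ →
    (∃! b : Fin (n - 1), bondPair (γ (m - 1)) b = F.outPair) ∧
    ∀ t < m - 1, ∀ b : Fin (n - 1), bondPair (γ t) b ≠ F.outPair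
  /-- A legal state whose class contains an illegal state reaches an illegal state within `R`
  transitions (forwards or backwards). -/
  evolve_illegal : ∀ c : Fin n → Fin C, F.Legal c → (∃ c', F.Connected c c' ∧ ¬ F.Legal c') →
    ∃ j ≤ R, ∃ π : ℕ → Fin n → Fin C, π 0 = c ∧ ¬ F.Legal (π j) ∧
      ((∀ i < j, F.Step (π i) (π (i + 1))) ∨ (∀ i < j, F.Step (π (i + 1)) (π i)))

/-! ### Encoding a verification computation -/

/-- The register unitary `U_{t-1} ⋯ U_1 U_0` along an evolution. -/
def registerUnitary (F : StandardForm C Q) {n : ℕ} (γ : ℕ → Fin n → Fin C) :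
    ℕ → Matrix (Fin n → Fin Q) (Fin n → Fin Q) ℂ
  | 0 => 1
  | t + 1 => F.stepGate (γ t) (γ (t + 1)) * F.registerUnitary γ t

/-- The block `⟨c| A |c⟩` of an operator on the chain, an operator on the quantum register. -/
def clockBlock {n : ℕ} (A : Matrix (ChainBasis n C Q) (ChainBasis n C Q) ℂ)
    (c : Fin n → Fin C) : Matrix (Fin n → Fin Q) (Fin n → Fin Q) ℂ :=
  fun s s' => A (c, s) (c, s')

/-- The register state `φ` is correctly initialised: `H_in` gives it no penalty. -/
def Initialised (F : StandardForm C Q) {n : ℕ} (T : ℕ) (γ : ℕ → Fin n → Fin C)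
    (φ : EuclideanSpace ℂ (Fin n → Fin Q)) : Prop :=
  ∀ t < T, (clockBlock (F.chainIn n) (γ t)).mulVec (fun s => φ s) = 0

/-- The probability `⟨φ| U† Π_out U |φ⟩` that the computation, started in the register state `φ`,
ends in a rejecting state, with `U = U_{T-2} ⋯ U_0` and `Π_out = ⟨T-1| H_out |T-1⟩`. -/
def rejectionProb (F : StandardForm C Q) {n : ℕ} (T : ℕ) (γ : ℕ → Fin n → Fin C)
    (φ : EuclideanSpace ℂ (Fin n → Fin Q)) : ℝ :=
  let χ : (Fin n → Fin Q) → ℂ := (F.registerUnitary γ (T - 1)).mulVec (fun s => φ s)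
  (dotProduct (star χ) ((clockBlock (F.chainOut n) (γ (T - 1))).mulVec χ)).re

/-- Along a valid evolution of `T` clock states, the Hamiltonian encodes the verification of the
instance `x` by `M` with witnesses of at most `q` qubits: witnesses embed isometrically into the
correctly initialised register states, with the rejection probability of the machine, and no
correctly initialised register state does better than all witnesses. -/
def EncodesVerification (F : StandardForm C Q) (n T : ℕ) (M : QTM) (x : List Bool) (q : ℕ) :
    Prop :=
  ∃ γ : ℕ → Fin n → Fin C, F.IsEvolution T γ ∧
    (∀ k ≤ q, ∃ E : EuclideanSpace ℂ (Fin k → Bool) →ₗᵢ[ℂ] EuclideanSpace ℂ (Fin n → Fin Q),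
      ∀ w, ‖w‖ = 1 → F.Initialised T γ (E w) ∧ M.RejectsWithProb x w (F.rejectionProb T γ (E w))) ∧
    (∀ φ, ‖φ‖ = 1 → F.Initialised T γ φ → ∀ r : ℝ,
      (∀ k ≤ q, ∀ w : EuclideanSpace ℂ (Fin k → Bool), ‖w‖ = 1 →
        ∀ r', M.RejectsWithProb x w r' → r ≤ r') → r ≤ F.rejectionProb T γ φ)

end StandardForm

/-! ### Ground state energy -/

/-- The real eigenvalues of a matrix (all of them, for a Hermitian one). -/
def energies {ι : Type} [Fintype ι] [DecidableEq ι] (H : Matrix ι ι ℂ) : Set ℝ :=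
  {e : ℝ | Module.End.HasEigenvalue (Matrix.toLin' H) (e : ℂ)}

/-- The ground state energy, i.e. the least eigenvalue. -/
def groundEnergy {ι : Type} [Fintype ι] [DecidableEq ι] (H : Matrix ι ι ℂ) : ℝ :=
  sInf (energies H)

end

/-!
The matrix `H` is a sum of positive semidefinite terms, so its least eigenvalue is nonnegative and
bounded above by the Rayleigh quotient of any vector (`groundEnergy_mul_le`). A good vector is a
history state whose rejected part is damped towards the end of the computation.

Let `φ` be the register state of a witness with rejection probability `r ≤ η`, and let `U` be the
whole computation. Split `φ = a + b`, where `b = U† Π_out U φ`; then `a ⟂ b`, `‖b‖² = r`, and `a`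
is accepted with certainty. For a real profile `g` consider
`ψ = ∑ₜ |t⟩ ⊗ U_{t-1} ⋯ U_0 (a + g t • b)`.
* If `g = 1` before `Tinit`, then `ψ` has no `H_in` energy: the register is still in the state `φ`
  before `Tinit`, and `H_in` does not act afterwards.
* If `g` vanishes at the last time step, then only `a` arrives there, and `ψ` has no `H_out` energy.
* The clock states of an evolution are legal, so `ψ` has no `H_pen` energy.
* Written in clock blocks, `H_trans` is one half of a graph Laplacian with gates on the edges
  (`StandardForm.sum_atBond_hTrans_apply`); along the evolution the gates are absorbed by the
  history state, and the energy of `ψ` is at most `r * (1/2 * ∑ₜ (g (t + 1) - g t)²)`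
  (`StandardForm.exists_historyState`).

For `Tinit > 0` the profile is `1` up to the time `Tinit - 1` and then a quarter of a cosine wave
down to `0`. With `N = T - Tinit` and `θ = π / (2 N + 1)`, the wave is the ground state of a path of
`N` vertices with one free and one bound end, so its kinetic energy is `1 - cos θ` times its squared
norm (`exists_profile`). Since `g² ≤ 1`, the squared norm `∑ₜ (1 - r + r (g t)²)` of `ψ` is at least
`∑ₜ (g t)²`, and the Rayleigh quotient is at most `r * (1 - cos θ)`. For `Tinit = 0` there is no
constraint from `H_in`, and `g = 0` gives energy `0`; `ψ ≠ 0` because `r < 1`.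

Finally `Tinit = o(T)`, so `1 - cos θ ≤ θ² / 2` is of order `1 / T²`
(`exists_one_sub_cos_le_div_sq`).
-/

/-! ### The ground state energy of a matrix -/

open Matrix in
theorem energies_isLeast {ι : Type} [Fintype ι] [DecidableEq ι] [Nonempty ι] {H : Matrix ι ι ℂ}
    (hH : H.IsHermitian) : IsLeast (energies H) (groundEnergy H) := by
  have hne : (energies H).Nonempty := by
    obtain ⟨i⟩ := ‹Nonempty ι›
    refine ⟨hH.eigenvalues i, ?_⟩
    refine Module.End.hasEigenvalue_of_hasEigenvector
      (x := (hH.eigenvectorBasis i : ι → ℂ)) ⟨?_, ?_⟩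
    · rw [Module.End.mem_eigenspace_iff, Matrix.toLin'_apply, hH.mulVec_eigenvectorBasis]
      ext; simp
    · intro h
      have := hH.eigenvectorBasis.orthonormal.ne_zero i
      exact this (by ext j; exact congrFun h j)
  have hfin : (energies H).Finite := by
    have := Module.End.finite_hasEigenvalue (Matrix.toLin' H)
    exact Set.Finite.preimage (Complex.ofReal_injective.injOn) this
  exact ⟨hne.csInf_mem hfin, fun e he => csInf_le hfin.bddBelow he⟩

open Matrix ComplexOrder in
/-- The variational principle. -/
theorem groundEnergy_mul_le {ι : Type} [Fintype ι] [DecidableEq ι] [Nonempty ι]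
    {H : Matrix ι ι ℂ} (hH : H.IsHermitian) (ψ : ι → ℂ) :
    groundEnergy H * (star ψ ⬝ᵥ ψ).re ≤ (star ψ ⬝ᵥ H *ᵥ ψ).re := by
  have hsub : (H - (groundEnergy H : ℂ) • (1 : Matrix ι ι ℂ)).IsHermitian := by
    apply hH.sub
    simp [Matrix.IsHermitian, Matrix.conjTranspose_smul]
  have hpos : (H - (groundEnergy H : ℂ) • (1 : Matrix ι ι ℂ)).PosSemidef := by
    rw [hsub.posSemidef_iff_eigenvalues_nonneg]
    intro i
    have hv := hsub.mulVec_eigenvectorBasis i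
    have hmem : hsub.eigenvalues i + groundEnergy H ∈ energies H := by
      refine Module.End.hasEigenvalue_of_hasEigenvector
        (x := (hsub.eigenvectorBasis i : ι → ℂ)) ⟨?_, ?_⟩
      · rw [Module.End.mem_eigenspace_iff, Matrix.toLin'_apply]
        rw [Matrix.sub_mulVec, Matrix.smul_mulVec, Matrix.one_mulVec, sub_eq_iff_eq_add] at hv
        rw [hv]
        ext; simp [add_mul]
      · intro h
        have := hsub.eigenvectorBasis.orthonormal.ne_zero i
        exact this (by ext j; exact congrFun h j)
    have := (energies_isLeast hH).2 hmem
    simp only [Pi.zero_apply]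
    linarith
  have h := hpos.re_dotProduct_nonneg ψ
  rw [Matrix.sub_mulVec, Matrix.smul_mulVec, Matrix.one_mulVec, dotProduct_sub,
    dotProduct_smul] at h
  simp at h
  linarith

open Matrix ComplexOrder in
theorem groundEnergy_nonneg {ι : Type} [Fintype ι] [DecidableEq ι] [Nonempty ι]
    {H : Matrix ι ι ℂ} (hH : H.PosSemidef) : 0 ≤ groundEnergy H := by
  obtain ⟨v, hv⟩ := (energies_isLeast hH.1).1.exists_hasEigenvector
  have h1 := hH.re_dotProduct_nonneg v
  have h2 := hv.apply_eq_smul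
  rw [Matrix.toLin'_apply] at h2
  rw [h2, dotProduct_smul] at h1
  have h3 : 0 < star v ⬝ᵥ v := dotProduct_star_self_pos_iff.2 hv.2
  obtain ⟨h4, h5⟩ := Complex.pos_iff.1 h3
  simp [← h5] at h1
  exact nonneg_of_mul_nonneg_left h1 h4

/-! ### Two-site operators as Kronecker products -/

theorem leftSite_ne_rightSite {n : ℕ} (b : Fin (n - 1)) : leftSite b ≠ rightSite b := by
  simp [leftSite, rightSite]

/-- The restriction of a basis state to the sites off a bond. -/
def bondRest {n : ℕ} {α : Type} (b : Fin (n - 1)) (c : Fin n → α) :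
    {j : Fin n // j ≠ leftSite b ∧ j ≠ rightSite b} → α := fun j => c j

theorem agreeOff_iff {n : ℕ} {α : Type} {b : Fin (n - 1)} {c c' : Fin n → α} :
    AgreeOff b c c' ↔ bondRest b c = bondRest b c' := by
  constructor
  · intro h; ext j; exact h j j.2.1 j.2.2
  · intro h j h1 h2; exact congrFun h ⟨j, h1, h2⟩

theorem AgreeOff.symm {n : ℕ} {α : Type} {b : Fin (n - 1)} {c c' : Fin n → α}
    (h : AgreeOff b c c') : AgreeOff b c' c := fun j h1 h2 => (h j h1 h2).symm

theorem bondPair_eq_and_agreeOff_iff {n : ℕ} {α : Type} {b : Fin (n - 1)} {c c' : Fin n → α} :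
    (bondPair c b = bondPair c' b ∧ AgreeOff b c c') ↔ c = c' := by
  constructor
  · rintro ⟨h, h'⟩
    simp only [bondPair, Prod.mk.injEq] at h
    ext j
    by_cases h1 : j = leftSite b
    · rw [h1, h.1]
    by_cases h2 : j = rightSite b
    · rw [h2, h.2]
    exact h' j h1 h2
  · rintro rfl; exact ⟨rfl, fun _ _ _ => rfl⟩

/-- A basis state is given by its symbols on a bond and its symbols off the bond. -/
def bondEquiv {n : ℕ} (α : Type) (b : Fin (n - 1)) :
    (Fin n → α) ≃ (α × α) × ({j : Fin n // j ≠ leftSite b ∧ j ≠ rightSite b} → α) where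
  toFun c := (bondPair c b, bondRest b c)
  invFun p j := if h : j = leftSite b then p.1.1 else if h' : j = rightSite b then p.1.2 else
    p.2 ⟨j, h, h'⟩
  left_inv c := by
    ext j
    dsimp [bondPair, bondRest]
    split_ifs with h h'
    · rw [h]
    · rw [h']
    · rfl
  right_inv p := by
    have h := (leftSite_ne_rightSite b).symm
    ext j
    · simp [bondPair]
    · simp [bondPair, h]
    · simp [bondRest, j.2.1, j.2.2]

theorem exists_bondPair_eq {n : ℕ} {α : Type} (b : Fin (n - 1)) (c : Fin n → α) (p : α × α) :
    ∃ c' : Fin n → α, bondPair c' b = p ∧ AgreeOff b c c' := by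
  obtain ⟨c', hc'⟩ := (bondEquiv α b).surjective (p, bondRest b c)
  simp only [bondEquiv, Equiv.coe_fn_mk, Prod.mk.injEq] at hc'
  exact ⟨c', hc'.1, agreeOff_iff.2 hc'.2.symm⟩

open Matrix Kronecker in
theorem registerAtBond_eq_kronecker {n Q : ℕ} (g : Matrix (Fin Q × Fin Q) (Fin Q × Fin Q) ℂ)
    (b : Fin (n - 1)) : registerAtBond g b =
      (g ⊗ₖ (1 : Matrix ({j : Fin n // j ≠ leftSite b ∧ j ≠ rightSite b} → Fin Q) _ ℂ)).submatrix
        (bondEquiv (Fin Q) b) (bondEquiv (Fin Q) b) := by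
  ext s s'
  simp [registerAtBond, agreeOff_iff, bondEquiv, Matrix.one_apply]

open Matrix Kronecker in
theorem registerAtBond_unitary {n Q : ℕ} {g : Matrix (Fin Q × Fin Q) (Fin Q × Fin Q) ℂ}
    (hg : gᴴ * g = 1) (b : Fin (n - 1)) :
    (registerAtBond g b)ᴴ * registerAtBond g b = 1 := by
  rw [registerAtBond_eq_kronecker, conjTranspose_submatrix, submatrix_mul_equiv,
    conjTranspose_kronecker, ← mul_kronecker_mul]
  simp [hg]

open Matrix Kronecker ComplexOrder in
theorem atBond_posSemidef {n C Q : ℕ} {h : Matrix (PairBasis C Q) (PairBasis C Q) ℂ}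
    (hh : h.PosSemidef) (b : Fin (n - 1)) : (atBond h b).PosSemidef := by
  have key : atBond h b = (h ⊗ₖ (1 : Matrix
      (({j : Fin n // j ≠ leftSite b ∧ j ≠ rightSite b} → Fin C) ×
        ({j : Fin n // j ≠ leftSite b ∧ j ≠ rightSite b} → Fin Q)) _ ℂ)).submatrix
      (fun u : ChainBasis n C Q =>
        ((bondPair u.1 b, bondPair u.2 b), (bondRest b u.1, bondRest b u.2)))
      (fun u : ChainBasis n C Q =>
        ((bondPair u.1 b, bondPair u.2 b), (bondRest b u.1, bondRest b u.2))) := by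
    ext u v
    simp [atBond, agreeOff_iff, Matrix.one_apply]
  rw [key]
  exact (hh.kronecker PosSemidef.one).submatrix _

theorem atBond_diagonal {n C Q : ℕ} (f : PairBasis C Q → ℂ) (b : Fin (n - 1)) :
    atBond (Matrix.diagonal f) b =
      Matrix.diagonal fun u : ChainBasis n C Q => f (bondPair u.1 b, bondPair u.2 b) := by
  ext u v
  by_cases huv : u = v
  · subst huv
    have h1 : AgreeOff b u.1 u.1 := fun _ _ _ => rfl
    have h2 : AgreeOff b u.2 u.2 := fun _ _ _ => rfl
    simp [atBond, h1, h2]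
  · rw [Matrix.diagonal_apply_ne _ huv]
    simp only [atBond]
    split_ifs with h
    · apply Matrix.diagonal_apply_ne
      intro h'
      simp only [Prod.mk.injEq] at h'
      exact huv (Prod.ext (bondPair_eq_and_agreeOff_iff.1 ⟨h'.1, h.1⟩)
        (bondPair_eq_and_agreeOff_iff.1 ⟨h'.2, h.2⟩))
    · rfl

/-! ### The standard-form Hamiltonian -/

namespace StandardForm
variable {C Q : ℕ}

open Matrix ComplexOrder in
theorem hamiltonian_posSemidef (F : StandardForm C Q) (n : ℕ) : (F.hamiltonian n).PosSemidef := by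
  have hd : ∀ p : PairBasis C Q → Prop, [DecidablePred p] →
      (Matrix.diagonal fun u => if p u then (1 : ℂ) else 0).PosSemidef := by
    intro p _
    rw [posSemidef_diagonal_iff]
    intro u
    split_ifs <;> simp
  have htr : F.hTrans.PosSemidef := by
    refine posSemidef_sum _ fun r _ => ?_
    exact (posSemidef_self_mul_conjTranspose _).smul (by positivity)
  unfold hamiltonian chainIn chainOut
  exact (((posSemidef_sum _ fun b _ => atBond_posSemidef htr b).add
    (posSemidef_sum _ fun b _ => atBond_posSemidef (hd _) b)).add
    (posSemidef_sum _ fun b _ => atBond_posSemidef (hd _) b)).add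
    (posSemidef_sum _ fun b _ => atBond_posSemidef (hd _) b)

open Matrix in
/-- The matrix entries of `h_trans`: a diagonal part that counts rules, and one gate for each rule
in either direction. -/
theorem hTrans_apply (F : StandardForm C Q) (u v : PairBasis C Q) :
    F.hTrans u v = (1 / 2 : ℂ) * (
      (if u = v then ((F.rules.filter fun r => r.1 = u.1).card : ℂ) +
        ((F.rules.filter fun r => r.2 = u.1).card : ℂ) else 0) -
      (if (v.1, u.1) ∈ F.rules then (F.gate v.1 u.1).1 u.2 v.2 else 0) -
      (if (u.1, v.1) ∈ F.rules then star ((F.gate u.1 v.1).1 v.2 u.2) else 0)) := by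
  have key : ∀ r : (Fin C × Fin C) × (Fin C × Fin C),
      (F.ruleVec r.1 r.2 * (F.ruleVec r.1 r.2)ᴴ) u v =
        (if u = v then (if r.1 = u.1 then (1 : ℂ) else 0) + (if r.2 = u.1 then (1 : ℂ) else 0)
          else 0) -
        (if r = (v.1, u.1) then (F.gate v.1 u.1).1 u.2 v.2 else 0) -
        (if r = (u.1, v.1) then star ((F.gate u.1 v.1).1 v.2 u.2) else 0) := by
    rintro ⟨p, q⟩
    obtain ⟨u1, u2⟩ := u
    obtain ⟨v1, v2⟩ := v
    -- Naming the gate shields it from rewriting along the equations of clock pairs below.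
    obtain ⟨G, hG⟩ : ∃ G : Matrix (Fin Q × Fin Q) (Fin Q × Fin Q) ℂ, G = (F.gate p q).1 := ⟨_, rfl⟩
    have hU : ∑ s, G u2 s * star (G v2 s) = if u2 = v2 then 1 else 0 := by
      have h := congrFun (congrFun (mem_unitaryGroup_iff.1 (F.gate p q).2) u2) v2
      rwa [Matrix.mul_apply, Matrix.one_apply, ← hG] at h
    have f1 : ∑ s, (if u1 = q then G u2 s else 0) * star (if v1 = q then G v2 s else 0) =
        if (u1, u2) = (v1, v2) then (if q = u1 then 1 else 0) else 0 := by
      by_cases h1 : u1 = q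
      · by_cases h2 : v1 = q
        · simp only [if_pos h1, if_pos h2, hU]; simp [h1, h2]
        · have : u1 ≠ v1 := fun h => h2 (h ▸ h1)
          simp [h2, this]
      · simp [h1, Ne.symm h1]
    have f2 : ∑ s, (if u1 = p then (1 : Matrix (Fin Q × Fin Q) (Fin Q × Fin Q) ℂ) u2 s else 0) *
          star (if v1 = p then (1 : Matrix (Fin Q × Fin Q) (Fin Q × Fin Q) ℂ) v2 s else 0) =
        if (u1, u2) = (v1, v2) then (if p = u1 then 1 else 0) else 0 := by
      by_cases h1 : u1 = p
      · by_cases h2 : v1 = p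
        · simp [h1, h2, Matrix.one_apply]
        · have : u1 ≠ v1 := fun h => h2 (h ▸ h1)
          simp [h2, this]
      · simp [h1, Ne.symm h1]
    have f3 : ∑ s, (if u1 = q then G u2 s else 0) *
          star (if v1 = p then (1 : Matrix (Fin Q × Fin Q) (Fin Q × Fin Q) ℂ) v2 s else 0) =
        if (p, q) = (v1, u1) then (F.gate v1 u1).1 u2 v2 else 0 := by
      by_cases h1 : u1 = q
      · by_cases h2 : v1 = p
        · simp [h1, h2, hG, Matrix.one_apply, apply_ite]
        · simp [h2, Ne.symm h2]
      · simp [h1, Ne.symm h1]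
    have f4 : ∑ s, (if u1 = p then (1 : Matrix (Fin Q × Fin Q) (Fin Q × Fin Q) ℂ) u2 s else 0) *
          star (if v1 = q then G v2 s else 0) =
        if (p, q) = (u1, v1) then star ((F.gate u1 v1).1 v2 u2) else 0 := by
      by_cases h1 : u1 = p
      · by_cases h2 : v1 = q
        · simp [h1, h2, hG, Matrix.one_apply]
        · simp [h2, Ne.symm h2]
      · simp [h1, Ne.symm h1]
    simp only [Matrix.mul_apply, conjTranspose_apply, ruleVec, ← hG, star_sub, sub_mul, mul_sub,
      Finset.sum_sub_distrib, f1, f2, f3, f4]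
    split_ifs <;> ring
  rw [hTrans, Matrix.sum_apply]
  simp only [Matrix.smul_apply, key, smul_eq_mul, ← Finset.mul_sum]
  congr 1
  simp only [Finset.sum_sub_distrib, Finset.sum_ite_eq']
  congr 2
  split_ifs
  · simp [Finset.sum_add_distrib]
  · simp

end StandardForm

/-! ### Clock blocks -/

theorem sum_atBond_diagonal {n C Q : ℕ} (f : PairBasis C Q → ℂ) :
    ∑ b : Fin (n - 1), atBond (Matrix.diagonal f) b = Matrix.diagonal fun u : ChainBasis n C Q =>
      ∑ b, f (bondPair u.1 b, bondPair u.2 b) := by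
  ext u v
  simp only [atBond_diagonal, Matrix.sum_apply, Matrix.diagonal_apply]
  split_ifs <;> simp

/-- The vector `|c⟩ ⊗ |Φ⟩`. -/
def clockKet {n C Q : ℕ} (c : Fin n → Fin C) (Φ : (Fin n → Fin Q) → ℂ) : ChainBasis n C Q → ℂ :=
  fun u => if u.1 = c then Φ u.2 else 0

open Matrix in
theorem clockKet_dotProduct {n C Q : ℕ} (c : Fin n → Fin C) (Φ : (Fin n → Fin Q) → ℂ)
    (ψ : ChainBasis n C Q → ℂ) :
    star (clockKet c Φ) ⬝ᵥ ψ = star Φ ⬝ᵥ fun s => ψ (c, s) := by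
  simp [dotProduct, clockKet, Fintype.sum_prod_type, apply_ite, ite_mul]

open Matrix in
theorem mulVec_clockKet {n C Q : ℕ} (A : Matrix (ChainBasis n C Q) (ChainBasis n C Q) ℂ)
    (c' : Fin n → Fin C) (Φ : (Fin n → Fin Q) → ℂ) (u : ChainBasis n C Q) :
    (A *ᵥ clockKet c' Φ) u = ∑ s', A u (c', s') * Φ s' := by
  simp [Matrix.mulVec, dotProduct, clockKet, Fintype.sum_prod_type, mul_ite]

open Matrix in
theorem diagonal_mulVec_sum_clockKet_eq_zero {n C Q : ℕ} {d : ChainBasis n C Q → ℂ} {I : Finset ℕ}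
    {γ : ℕ → Fin n → Fin C} {Φ : ℕ → (Fin n → Fin Q) → ℂ}
    (h : ∀ t ∈ I, ∀ s, d (γ t, s) * Φ t s = 0) :
    Matrix.diagonal d *ᵥ ∑ t ∈ I, clockKet (γ t) (Φ t) = 0 := by
  ext ⟨c, s⟩
  rw [Matrix.mulVec_diagonal, Finset.sum_apply, Finset.mul_sum]
  refine Finset.sum_eq_zero fun t ht => ?_
  simp only [clockKet]
  split_ifs with hc
  · subst hc; exact h t ht s
  · simp

open Matrix ComplexOrder in
theorem re_dotProduct_star_self_nonneg {ι : Type} [Fintype ι] (v : ι → ℂ) :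
    0 ≤ (star v ⬝ᵥ v).re :=
  (Complex.nonneg_iff.1 (dotProduct_star_self_nonneg v)).1

open Matrix in
theorem isometry_dotProduct {ι : Type} [Fintype ι] [DecidableEq ι] {U : Matrix ι ι ℂ}
    (hU : Uᴴ * U = 1) (v w : ι → ℂ) : star (U *ᵥ v) ⬝ᵥ U *ᵥ w = star v ⬝ᵥ w := by
  rw [star_mulVec, ← dotProduct_mulVec, mulVec_mulVec, hU, one_mulVec]

namespace StandardForm
variable {C Q : ℕ}

/-- The number of ways in which a transition rule applies to `c`. -/
def outDegree (F : StandardForm C Q) {n : ℕ} (c : Fin n → Fin C) : ℕ :=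
  ∑ b : Fin (n - 1), (F.rules.filter fun r => r.1 = bondPair c b).card

/-- The number of ways in which a transition rule applies backwards to `c`. -/
def inDegree (F : StandardForm C Q) {n : ℕ} (c : Fin n → Fin C) : ℕ :=
  ∑ b : Fin (n - 1), (F.rules.filter fun r => r.2 = bondPair c b).card

theorem outDegree_le_one {F : StandardForm C Q} {n : ℕ} {c : Fin n → Fin C}
    (h : ∀ b₁ b₂ c₁ c₂, F.BondStep b₁ c c₁ → F.BondStep b₂ c c₂ → b₁ = b₂ ∧ c₁ = c₂) :
    F.outDegree c ≤ 1 := by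
  rw [outDegree, ← Finset.card_sigma, Finset.card_le_one]
  rintro ⟨b₁, p₁, q₁⟩ h₁ ⟨b₂, p₂, q₂⟩ h₂
  simp only [Finset.mem_sigma, Finset.mem_univ, Finset.mem_filter, true_and] at h₁ h₂
  obtain ⟨h₁, rfl⟩ := h₁
  obtain ⟨h₂, rfl⟩ := h₂
  obtain ⟨c₁, rfl, k₁⟩ := exists_bondPair_eq b₁ c q₁
  obtain ⟨c₂, rfl, k₂⟩ := exists_bondPair_eq b₂ c q₂
  obtain ⟨rfl, rfl⟩ := h b₁ b₂ c₁ c₂ ⟨h₁, k₁⟩ ⟨h₂, k₂⟩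
  rfl

theorem inDegree_le_one {F : StandardForm C Q} {n : ℕ} {c : Fin n → Fin C}
    (h : ∀ b₁ b₂ c₁ c₂, F.BondStep b₁ c₁ c → F.BondStep b₂ c₂ c → b₁ = b₂ ∧ c₁ = c₂) :
    F.inDegree c ≤ 1 := by
  rw [inDegree, ← Finset.card_sigma, Finset.card_le_one]
  rintro ⟨b₁, p₁, q₁⟩ h₁ ⟨b₂, p₂, q₂⟩ h₂
  simp only [Finset.mem_sigma, Finset.mem_univ, Finset.mem_filter, true_and] at h₁ h₂
  obtain ⟨h₁, rfl⟩ := h₁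
  obtain ⟨h₂, rfl⟩ := h₂
  obtain ⟨c₁, rfl, k₁⟩ := exists_bondPair_eq b₁ c p₁
  obtain ⟨c₂, rfl, k₂⟩ := exists_bondPair_eq b₂ c p₂
  obtain ⟨rfl, rfl⟩ := h b₁ b₂ c₁ c₂ ⟨h₁, k₁.symm⟩ ⟨h₂, k₂.symm⟩
  rfl

theorem outDegree_eq_zero {F : StandardForm C Q} {n : ℕ} {c : Fin n → Fin C}
    (h : ∀ c', ¬ F.Step c c') : F.outDegree c = 0 := by
  refine Finset.sum_eq_zero fun b _ => ?_
  rw [Finset.card_eq_zero, Finset.filter_eq_empty_iff]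
  rintro ⟨p, q⟩ hr rfl
  obtain ⟨c', rfl, k⟩ := exists_bondPair_eq b c q
  exact h c' ⟨b, hr, k⟩

theorem inDegree_eq_zero {F : StandardForm C Q} {n : ℕ} {c : Fin n → Fin C}
    (h : ∀ c', ¬ F.Step c' c) : F.inDegree c = 0 := by
  refine Finset.sum_eq_zero fun b _ => ?_
  rw [Finset.card_eq_zero, Finset.filter_eq_empty_iff]
  rintro ⟨p, q⟩ hr rfl
  obtain ⟨c', rfl, k⟩ := exists_bondPair_eq b c p
  exact h c' ⟨b, hr, k.symm⟩

/-- In clock blocks, `H_trans` is one half of the Laplacian of the graph of clock transitions, with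
the gates on its edges. -/
theorem sum_atBond_hTrans_apply (F : StandardForm C Q) {n : ℕ} (c c' : Fin n → Fin C)
    (s s' : Fin n → Fin Q) :
    (∑ b : Fin (n - 1), atBond F.hTrans b) (c, s) (c', s') = (1 / 2 : ℂ) * (
      (if (c, s) = (c', s') then (F.outDegree c : ℂ) + (F.inDegree c : ℂ) else 0) -
      F.stepGate c' c s s' - star (F.stepGate c c' s' s)) := by
  have hb : ∀ b : Fin (n - 1), atBond F.hTrans b (c, s) (c', s') = (1 / 2 : ℂ) * (
      (if (c, s) = (c', s') then
        ((F.rules.filter fun r => r.1 = bondPair c b).card : ℂ) +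
        ((F.rules.filter fun r => r.2 = bondPair c b).card : ℂ) else 0) -
      (open Classical in if F.BondStep b c' c then
        registerAtBond (F.gate (bondPair c' b) (bondPair c b)).1 b else 0) s s' -
      star ((open Classical in if F.BondStep b c c' then
        registerAtBond (F.gate (bondPair c b) (bondPair c' b)).1 b else 0) s' s)) := by
    intro b
    simp only [atBond]
    by_cases h1 : AgreeOff b c c'
    · by_cases h2 : AgreeOff b s s'
      · have e : ((bondPair c b, bondPair s b) = (bondPair c' b, bondPair s' b)) ↔
            (c, s) = (c', s') := by
          rw [Prod.mk.injEq (bondPair c b), Prod.mk.injEq c,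
            ← bondPair_eq_and_agreeOff_iff (b := b) (c := c),
            ← bondPair_eq_and_agreeOff_iff (b := b) (c := s)]
          tauto
        rw [if_pos ⟨h1, h2⟩, hTrans_apply]
        simp only [e]
        congr 2
        · congr 1
          by_cases h : (bondPair c' b, bondPair c b) ∈ F.rules
          · rw [if_pos h, if_pos ⟨h, h1.symm⟩, registerAtBond, if_pos h2]
          · rw [if_neg h, if_neg fun h' => h h'.1]; rfl
        · by_cases h : (bondPair c b, bondPair c' b) ∈ F.rules
          · rw [if_pos h, if_pos ⟨h, h1⟩, registerAtBond, if_pos (h2.symm)]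
          · rw [if_neg h, if_neg fun h' => h h'.1]; simp
      · have e : (c, s) ≠ (c', s') := by
          intro h
          simp only [Prod.mk.injEq] at h
          exact h2 (bondPair_eq_and_agreeOff_iff.2 h.2).2
        have h3 : ¬ AgreeOff b s' s := fun h => h2 (h.symm)
        rw [if_neg fun h => h2 h.2, if_neg e]
        split_ifs <;> simp [registerAtBond, h2, h3]
    · have e : (c, s) ≠ (c', s') := by
        intro h
        simp only [Prod.mk.injEq] at h
        exact h1 (bondPair_eq_and_agreeOff_iff.2 h.1).2
      rw [if_neg fun h => h1 h.1, if_neg e, if_neg fun h => h1 (h.2.symm),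
        if_neg fun h => h1 h.2]
      simp
  rw [Matrix.sum_apply, Finset.sum_congr rfl fun b _ => hb b, ← Finset.mul_sum]
  simp only [Finset.sum_sub_distrib, ← star_sum, ← Matrix.sum_apply]
  congr 3
  split_ifs
  · simp [Finset.sum_add_distrib, outDegree, inDegree]
  · simp

theorem stepGate_eq_zero {F : StandardForm C Q} {n : ℕ} {c c' : Fin n → Fin C}
    (h : ¬ F.Step c c') : F.stepGate c c' = 0 :=
  Finset.sum_eq_zero fun b _ => if_neg fun hb => h ⟨b, hb⟩

open Matrix in
theorem stepGate_unitary {F : StandardForm C Q} {n : ℕ} {c c' : Fin n → Fin C}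
    (h : ∀ b₁ b₂ c₁ c₂, F.BondStep b₁ c c₁ → F.BondStep b₂ c c₂ → b₁ = b₂ ∧ c₁ = c₂)
    (hs : F.Step c c') : (F.stepGate c c')ᴴ * F.stepGate c c' = 1 := by
  obtain ⟨b, hb⟩ := hs
  have : F.stepGate c c' = registerAtBond (F.gate (bondPair c b) (bondPair c' b)).1 b := by
    rw [stepGate, Finset.sum_eq_single b, if_pos hb]
    · intro b' _ hne
      exact if_neg fun hb' => hne (h _ _ _ _ hb' hb).1
    · simp
  rw [this]
  exact registerAtBond_unitary (mem_unitaryGroup_iff'.1 (F.gate _ _).2) b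

open Matrix in
theorem dotProduct_hTrans_clockKet (F : StandardForm C Q) {n : ℕ} (c c' : Fin n → Fin C)
    (Φ Φ' : (Fin n → Fin Q) → ℂ) :
    star (clockKet c Φ) ⬝ᵥ (∑ b : Fin (n - 1), atBond F.hTrans b) *ᵥ clockKet c' Φ' =
      (1 / 2 : ℂ) * ((if c = c' then ((F.outDegree c : ℂ) + F.inDegree c) * (star Φ ⬝ᵥ Φ') else 0)
        - star Φ ⬝ᵥ F.stepGate c' c *ᵥ Φ' - star (star Φ' ⬝ᵥ F.stepGate c c' *ᵥ Φ)) := by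
  have e : (fun s => ((∑ b : Fin (n - 1), atBond F.hTrans b) *ᵥ clockKet c' Φ') (c, s)) =
      (1 / 2 : ℂ) • ((if c = c' then ((F.outDegree c : ℂ) + F.inDegree c) • Φ' else 0)
        - F.stepGate c' c *ᵥ Φ' - (F.stepGate c c')ᴴ *ᵥ Φ') := by
    ext s
    rw [mulVec_clockKet]
    simp only [sum_atBond_hTrans_apply, Prod.mk.injEq]
    simp only [mul_assoc, ← Finset.mul_sum, sub_mul, Finset.sum_sub_distrib]
    simp only [Pi.smul_apply, Pi.sub_apply, smul_eq_mul, mulVec, dotProduct, conjTranspose_apply]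
    congr 3
    split_ifs with h
    · simp [h]
    · simp [h]
  rw [clockKet_dotProduct, e, dotProduct_smul, dotProduct_sub, dotProduct_sub, smul_eq_mul]
  congr 2
  · split_ifs
    · rw [dotProduct_smul, smul_eq_mul]
    · simp
  · rw [← star_dotProduct_star, star_star, star_mulVec, dotProduct_comm, ← dotProduct_mulVec]
    rw [dotProduct_comm]

end StandardForm

/-! ### History states of an evolution -/

namespace StandardForm
variable {C Q : ℕ}

/-- In each direction at most one rule, on one bond, applies to `c`. -/
def Deterministic (F : StandardForm C Q) {n : ℕ} (c : Fin n → Fin C) : Prop :=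
  (∀ b₁ b₂ c₁ c₂, F.BondStep b₁ c c₁ → F.BondStep b₂ c c₂ → b₁ = b₂ ∧ c₁ = c₂) ∧
    (∀ b₁ b₂ c₁ c₂, F.BondStep b₁ c₁ c → F.BondStep b₂ c₂ c → b₁ = b₂ ∧ c₁ = c₂)

theorem IsStandardFormClock.deterministic {F : StandardForm C Q} {n T Tinit R : ℕ}
    (h : F.IsStandardFormClock n T Tinit R) {c : Fin n → Fin C} (hc : F.Legal c) :
    F.Deterministic c := by
  obtain ⟨W, h1, -, h3, h4⟩ := h.wellFormed
  exact ⟨h3 c (h1 c hc), h4 c (h1 c hc)⟩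

theorem IsEvolution.step_iff {F : StandardForm C Q} {n m : ℕ} {γ : ℕ → Fin n → Fin C}
    (h : F.IsEvolution (m + 1) γ) (hd : ∀ t < m + 1, F.Deterministic (γ t)) {t t' : ℕ}
    (ht : t < m + 1) (ht' : t' < m + 1) : F.Step (γ t) (γ t') ↔ t' = t + 1 := by
  constructor
  · rintro ⟨b, hb⟩
    by_cases htm : t + 1 < m + 1
    · obtain ⟨b', hb'⟩ := h.step t htm
      exact h.injOn ht' htm ((hd t ht).1 _ _ _ _ hb hb').2
    · obtain rfl : t = m := by omega
      exact absurd ⟨b, hb⟩ (h.final _)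
  · rintro rfl
    exact h.step t ht'

open Matrix in
/-- The transition energy of a vector supported on an evolution. The bound is in fact an equality,
but only upper bounds on the numbers of applicable rules are needed. -/
theorem IsEvolution.hTrans_energy_le {F : StandardForm C Q} {n m : ℕ} {γ : ℕ → Fin n → Fin C}
    (h : F.IsEvolution (m + 1) γ) (hd : ∀ t < m + 1, F.Deterministic (γ t))
    (Φ : ℕ → (Fin n → Fin Q) → ℂ) :
    (star (∑ t ∈ Finset.range (m + 1), clockKet (γ t) (Φ t)) ⬝ᵥ
      (∑ b : Fin (n - 1), atBond F.hTrans b) *ᵥ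
        ∑ t ∈ Finset.range (m + 1), clockKet (γ t) (Φ t)).re ≤
      1 / 2 * ∑ t ∈ Finset.range m, ((star (Φ (t + 1)) ⬝ᵥ Φ (t + 1)).re +
        (star (Φ t) ⬝ᵥ Φ t).re -
        2 * (star (Φ (t + 1)) ⬝ᵥ F.stepGate (γ t) (γ (t + 1)) *ᵥ Φ t).re) := by
  have hx : ∀ t, 0 ≤ (star (Φ t) ⬝ᵥ Φ t).re :=
    fun t => re_dotProduct_star_self_nonneg _
  have hout : ∀ t < m + 1, (F.outDegree (γ t) : ℝ) ≤ if t = m then 0 else 1 := by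
    intro t ht
    split_ifs with h'
    · have := outDegree_eq_zero h.final
      rw [Nat.add_sub_cancel, ← h'] at this
      simp [this]
    · exact_mod_cast outDegree_le_one (hd t ht).1
  have hin : ∀ t < m + 1, (F.inDegree (γ t) : ℝ) ≤ if t = 0 then 0 else 1 := by
    intro t ht
    split_ifs with h'
    · simp [h', inDegree_eq_zero h.initial]
    · exact_mod_cast inDegree_le_one (hd t ht).2
  -- The gate between two clock states of the evolution vanishes unless they are consecutive.
  have hgate : ∀ t ∈ Finset.range (m + 1), ∀ t' ∈ Finset.range (m + 1), ∀ v w,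
      star v ⬝ᵥ F.stepGate (γ t) (γ t') *ᵥ w =
        if t' = t + 1 then star v ⬝ᵥ F.stepGate (γ t) (γ (t + 1)) *ᵥ w else 0 := by
    intro t ht t' ht' v w
    split_ifs with h'
    · rw [h']
    · rw [stepGate_eq_zero, zero_mulVec, dotProduct_zero]
      rwa [h.step_iff hd (Finset.mem_range.1 ht) (Finset.mem_range.1 ht')]
  have hinj : ∀ t ∈ Finset.range (m + 1), ∀ t' ∈ Finset.range (m + 1), γ t = γ t' ↔ t = t' :=
    fun t ht t' ht' => h.injOn.eq_iff (Finset.mem_range.1 ht) (Finset.mem_range.1 ht')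
  -- A double sum over pairs of consecutive times is a single sum.
  have hsucc : ∀ f : ℕ → ℂ, ∑ t ∈ Finset.range (m + 1), ∑ t' ∈ Finset.range (m + 1),
      (if t' = t + 1 then f t else 0) = ∑ t ∈ Finset.range m, f t := by
    intro f
    rw [Finset.sum_range_succ]
    simp only [Finset.sum_ite_eq', Finset.mem_range, lt_irrefl, if_false, add_zero]
    exact Finset.sum_congr rfl fun t ht => if_pos (by simpa using ht)
  have key : star (∑ t ∈ Finset.range (m + 1), clockKet (γ t) (Φ t)) ⬝ᵥ
      (∑ b : Fin (n - 1), atBond F.hTrans b) *ᵥ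
        ∑ t ∈ Finset.range (m + 1), clockKet (γ t) (Φ t) =
      (1 / 2 : ℂ) * (∑ t ∈ Finset.range (m + 1),
          ((F.outDegree (γ t) : ℂ) + F.inDegree (γ t)) * (star (Φ t) ⬝ᵥ Φ t) -
        ∑ t ∈ Finset.range m, star (Φ (t + 1)) ⬝ᵥ F.stepGate (γ t) (γ (t + 1)) *ᵥ Φ t -
        star (∑ t ∈ Finset.range m,
          star (Φ (t + 1)) ⬝ᵥ F.stepGate (γ t) (γ (t + 1)) *ᵥ Φ t)) := by
    rw [mulVec_sum, star_sum, sum_dotProduct]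
    simp only [dotProduct_sum, dotProduct_hTrans_clockKet, ← Finset.mul_sum,
      Finset.sum_sub_distrib]
    congr 3
    · refine Finset.sum_congr rfl fun t ht => ?_
      rw [Finset.sum_eq_single t]
      · simp
      · intro t' ht' hne
        rw [if_neg]
        rw [hinj t ht t' ht']
        exact hne.symm
      · exact fun h' => absurd ht h'
    · rw [Finset.sum_comm, ← hsucc]
      refine Finset.sum_congr rfl fun t ht => Finset.sum_congr rfl fun t' ht' => ?_
      rw [hgate t ht t' ht']
      split_ifs with h'
      · rw [h']
      · rfl
    · rw [← hsucc, star_sum]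
      refine Finset.sum_congr rfl fun t ht => ?_
      rw [star_sum]
      refine Finset.sum_congr rfl fun t' ht' => ?_
      rw [hgate t ht t' ht']
      split_ifs with h'
      · rw [h']
      · rfl
  have hdiag : ∑ t ∈ Finset.range (m + 1),
      ((F.outDegree (γ t) : ℝ) + F.inDegree (γ t)) * (star (Φ t) ⬝ᵥ Φ t).re ≤
      ∑ t ∈ Finset.range m, ((star (Φ (t + 1)) ⬝ᵥ Φ (t + 1)).re + (star (Φ t) ⬝ᵥ Φ t).re) := by
    have h1 : ∑ t ∈ Finset.range (m + 1), (F.outDegree (γ t) : ℝ) * (star (Φ t) ⬝ᵥ Φ t).re ≤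
        ∑ t ∈ Finset.range m, (star (Φ t) ⬝ᵥ Φ t).re := by
      calc _ ≤ ∑ t ∈ Finset.range (m + 1), (if t = m then 0 else 1) * (star (Φ t) ⬝ᵥ Φ t).re :=
            Finset.sum_le_sum fun t ht =>
              mul_le_mul_of_nonneg_right (hout t (Finset.mem_range.1 ht)) (hx t)
        _ = _ := by
            rw [Finset.sum_range_succ, if_pos rfl, zero_mul, add_zero]
            refine Finset.sum_congr rfl fun t ht => ?_
            rw [if_neg (Finset.mem_range.1 ht).ne, one_mul]
    have h2 : ∑ t ∈ Finset.range (m + 1), (F.inDegree (γ t) : ℝ) * (star (Φ t) ⬝ᵥ Φ t).re ≤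
        ∑ t ∈ Finset.range m, (star (Φ (t + 1)) ⬝ᵥ Φ (t + 1)).re := by
      calc _ ≤ ∑ t ∈ Finset.range (m + 1), (if t = 0 then 0 else 1) * (star (Φ t) ⬝ᵥ Φ t).re :=
            Finset.sum_le_sum fun t ht =>
              mul_le_mul_of_nonneg_right (hin t (Finset.mem_range.1 ht)) (hx t)
        _ = _ := by
            rw [Finset.sum_range_succ']
            simp
    simp only [add_mul, Finset.sum_add_distrib]
    linarith
  have hre : ((1 / 2 : ℂ) * (∑ t ∈ Finset.range (m + 1),
          ((F.outDegree (γ t) : ℂ) + F.inDegree (γ t)) * (star (Φ t) ⬝ᵥ Φ t) -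
        ∑ t ∈ Finset.range m, star (Φ (t + 1)) ⬝ᵥ F.stepGate (γ t) (γ (t + 1)) *ᵥ Φ t -
        star (∑ t ∈ Finset.range m,
          star (Φ (t + 1)) ⬝ᵥ F.stepGate (γ t) (γ (t + 1)) *ᵥ Φ t))).re =
      1 / 2 * (∑ t ∈ Finset.range (m + 1),
          ((F.outDegree (γ t) : ℝ) + F.inDegree (γ t)) * (star (Φ t) ⬝ᵥ Φ t).re -
        2 * ∑ t ∈ Finset.range m,
          (star (Φ (t + 1)) ⬝ᵥ F.stepGate (γ t) (γ (t + 1)) *ᵥ Φ t).re) := by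
    have e : (1 / 2 : ℂ) = ((1 / 2 : ℝ) : ℂ) := by norm_num
    rw [e, Complex.re_ofReal_mul]
    simp only [Complex.sub_re, Complex.re_sum, RCLike.star_def, Complex.conj_re, Complex.mul_re,
      Complex.add_re, Complex.natCast_re, Complex.add_im, Complex.natCast_im, add_zero, zero_mul,
      sub_zero]
    ring
  rw [key, hre, Finset.sum_sub_distrib, ← Finset.mul_sum]
  linarith

open Matrix in
theorem IsEvolution.registerUnitary_unitary {F : StandardForm C Q} {n m : ℕ}
    {γ : ℕ → Fin n → Fin C} (h : F.IsEvolution (m + 1) γ)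
    (hd : ∀ t < m + 1, F.Deterministic (γ t)) :
    ∀ t < m + 1, (F.registerUnitary γ t)ᴴ * F.registerUnitary γ t = 1 := by
  intro t
  induction t with
  | zero => intro _; simp [registerUnitary]
  | succ t ih =>
    intro ht
    rw [registerUnitary, conjTranspose_mul, Matrix.mul_assoc,
      ← Matrix.mul_assoc _ᴴ (stepGate _ _ _),
      stepGate_unitary (hd t (by omega)).1 (h.step t ht), Matrix.one_mul, ih (by omega)]

theorem IsEvolution.registerUnitary_eq_one {F : StandardForm C Q} {n T Tinit R m : ℕ}
    {γ : ℕ → Fin n → Fin C} (hF : F.IsStandardFormClock n T Tinit R) (h : F.IsEvolution m γ) :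
    ∀ t < m, t ≤ Tinit → F.registerUnitary γ t = 1 := by
  intro t
  induction t with
  | zero => intro _ _; rfl
  | succ t ih =>
    intro ht ht'
    rw [registerUnitary, ih (by omega) (by omega), hF.init_trivial m γ h t (by omega) ht,
      Matrix.one_mul]

theorem clockBlock_diagonal {n : ℕ} (d : ChainBasis n C Q → ℂ) (c : Fin n → Fin C) :
    clockBlock (Matrix.diagonal d) c = Matrix.diagonal fun s => d (c, s) := by
  ext s s'
  simp [clockBlock, Matrix.diagonal_apply]

open Matrix in
/-- The history state in which the component of `φ` that ends up rejected has its amplitude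
multiplied by `g t` at the time `t`: its squared norm, and a bound on its energy. -/
theorem exists_historyState {F : StandardForm C Q} {n m Tinit R : ℕ}
    (hF : F.IsStandardFormClock n (m + 1) Tinit R) {γ : ℕ → Fin n → Fin C}
    (hγ : F.IsEvolution (m + 1) γ) {φ : EuclideanSpace ℂ (Fin n → Fin Q)} (hφ : ‖φ‖ = 1)
    (hinit : F.Initialised (m + 1) γ φ) (g : ℕ → ℝ) (hg : ∀ t < Tinit, g t = 1) (hgm : g m = 0) :
    0 ≤ F.rejectionProb (m + 1) γ φ ∧ ∃ ψ : ChainBasis n C Q → ℂ,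
      (star ψ ⬝ᵥ ψ).re = ∑ t ∈ Finset.range (m + 1), (1 - F.rejectionProb (m + 1) γ φ +
        F.rejectionProb (m + 1) γ φ * g t ^ 2) ∧
      (star ψ ⬝ᵥ F.hamiltonian n *ᵥ ψ).re ≤ F.rejectionProb (m + 1) γ φ *
        (1 / 2 * ∑ t ∈ Finset.range m, (g (t + 1) - g t) ^ 2) := by
  have hd : ∀ t < m + 1, F.Deterministic (γ t) := fun t ht => hF.deterministic (hγ.legal t ht)
  have hU := hγ.registerUnitary_unitary hd
  set U := F.registerUnitary γ m with hUm
  have hUm1 : Uᴴ * U = 1 := hU m (by omega)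
  have hUm2 : U * Uᴴ = 1 := mul_eq_one_comm.1 hUm1
  obtain ⟨⟨b₀, hb₀, hb₀'⟩, hlast⟩ := hF.final_detect _ _ hγ
  rw [Nat.add_sub_cancel] at hb₀ hb₀' hlast
  -- The projection onto the rejecting register states.
  let ρ : (Fin n → Fin Q) → ℂ := fun s => if bondPair s b₀ ∈ F.outPenalty then 1 else 0
  let P : Matrix (Fin n → Fin Q) (Fin n → Fin Q) ℂ := Matrix.diagonal ρ
  have hP : ∀ v s, (P *ᵥ v) s = ρ s * v s := fun v s => Matrix.mulVec_diagonal _ _ _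
  have hρ : ∀ s, ρ s * ρ s = ρ s := fun s => by simp [ρ]
  have hρ' : ∀ s, star (ρ s) = ρ s := fun s => by simp [ρ, apply_ite]
  have hPP : ∀ v, P *ᵥ P *ᵥ v = P *ᵥ v := fun v => by
    ext s; rw [hP, hP, ← mul_assoc, hρ]
  have hPsa : ∀ v w, star (P *ᵥ v) ⬝ᵥ w = star v ⬝ᵥ P *ᵥ w := fun v w => by
    simp only [dotProduct, hP, Pi.star_apply, star_mul', hρ']
    exact Finset.sum_congr rfl fun s _ => by ring
  have hout : F.chainOut n = Matrix.diagonal fun u : ChainBasis n C Q =>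
      ∑ b, if bondPair u.1 b = F.outPair ∧ bondPair u.2 b ∈ F.outPenalty then (1 : ℂ) else 0 :=
    sum_atBond_diagonal _
  have hin : F.chainIn n = Matrix.diagonal fun u : ChainBasis n C Q =>
      ∑ b, if bondPair u.2 b ∈ F.inPenalty (bondPair u.1 b) then (1 : ℂ) else 0 :=
    sum_atBond_diagonal _
  have hpen : ∑ b : Fin (n - 1), atBond F.hPen b = Matrix.diagonal fun u : ChainBasis n C Q =>
      ∑ b, if bondPair u.1 b ∈ F.illegal then (1 : ℂ) else 0 :=
    sum_atBond_diagonal _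
  have houtm : ∀ s : Fin n → Fin Q, (∑ b, if bondPair (γ m) b = F.outPair ∧
      bondPair s b ∈ F.outPenalty then (1 : ℂ) else 0) = ρ s := by
    intro s
    rw [Finset.sum_eq_single b₀]
    · simp [hb₀, ρ]
    · intro b _ hb
      exact if_neg fun h => hb (hb₀' b h.1)
    · simp
  have hblock : clockBlock (F.chainOut n) (γ m) = P := by
    rw [hout, clockBlock_diagonal]
    exact congrArg Matrix.diagonal (funext houtm)
  let f : (Fin n → Fin Q) → ℂ := fun s => φ s
  have hf : star f ⬝ᵥ f = 1 := by
    have h1 : inner ℂ φ φ = (1 : ℂ) := by rw [inner_self_eq_norm_sq_to_K, hφ]; simp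
    rw [EuclideanSpace.inner_eq_star_dotProduct, dotProduct_comm] at h1
    exact h1
  -- `b` evolves into the rejecting part of the output, and `a` into the accepting part.
  let b : (Fin n → Fin Q) → ℂ := Uᴴ *ᵥ P *ᵥ U *ᵥ f
  let a : (Fin n → Fin Q) → ℂ := f - b
  have hUb : U *ᵥ b = P *ᵥ U *ᵥ f := by
    simp only [b, mulVec_mulVec, ← Matrix.mul_assoc, hUm2, Matrix.one_mul]
  have hPUa : P *ᵥ U *ᵥ a = 0 := by
    rw [mulVec_sub, mulVec_sub, hUb, hPP, sub_self]
  have hab : star a ⬝ᵥ b = 0 := by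
    rw [← isometry_dotProduct hUm1, hUb, ← hPsa, hPUa]; simp
  have hba : star b ⬝ᵥ a = 0 := by
    rw [← isometry_dotProduct hUm1, hUb, hPsa, hPUa]; simp
  set r := F.rejectionProb (m + 1) γ φ with hr
  have hbb' : star b ⬝ᵥ b = star (U *ᵥ f) ⬝ᵥ P *ᵥ U *ᵥ f := by
    rw [← isometry_dotProduct hUm1, hUb, hPsa, hPP]
  have hbb : (star b ⬝ᵥ b).re = r := by
    rw [hbb', hr, rejectionProb]
    simp only [Nat.add_sub_cancel, hblock]
    rfl
  have haa : (star a ⬝ᵥ a).re = 1 - r := by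
    have h1 : f = a + b := by simp [a]
    have h2 := congrArg Complex.re hf
    rw [h1, star_add, add_dotProduct, dotProduct_add, dotProduct_add, hab, hba] at h2
    simp only [Complex.add_re, Complex.zero_re, hbb, Complex.one_re] at h2
    linarith
  have hr0 : 0 ≤ r := by
    rw [← hbb]
    exact re_dotProduct_star_self_nonneg _
  refine ⟨hr0, ?_⟩
  let χ : ℕ → (Fin n → Fin Q) → ℂ := fun t => a + (g t : ℂ) • b
  have hχ : ∀ t t', (star (χ t) ⬝ᵥ χ t').re = 1 - r + r * (g t * g t') := by
    intro t t'
    simp only [χ, star_add, star_smul, add_dotProduct, dotProduct_add, smul_dotProduct,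
      dotProduct_smul, hab, hba, Complex.add_re, haa, RCLike.star_def, Complex.conj_ofReal,
      smul_eq_mul, Complex.re_ofReal_mul, hbb, mul_zero, Complex.zero_re]
    ring
  let Φ : ℕ → (Fin n → Fin Q) → ℂ := fun t => F.registerUnitary γ t *ᵥ χ t
  have hΦ : ∀ t < m + 1, star (Φ t) ⬝ᵥ Φ t = star (χ t) ⬝ᵥ χ t :=
    fun t ht => isometry_dotProduct (hU t ht) _ _
  refine ⟨∑ t ∈ Finset.range (m + 1), clockKet (γ t) (Φ t), ?_, ?_⟩
  · rw [star_sum, sum_dotProduct, Complex.re_sum]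
    refine Finset.sum_congr rfl fun t ht => ?_
    have e : (fun s => (∑ t ∈ Finset.range (m + 1), clockKet (γ t) (Φ t)) (γ t, s)) = Φ t := by
      ext s
      rw [Finset.sum_apply, Finset.sum_eq_single t]
      · simp [clockKet]
      · intro t' ht' hne
        refine if_neg fun h => hne ?_
        exact (hγ.injOn (Finset.mem_range.1 ht) (Finset.mem_range.1 ht') h).symm
      · exact fun h => absurd ht h
    rw [clockKet_dotProduct, e, hΦ t (Finset.mem_range.1 ht), hχ, ← sq]
  · have z1 : (∑ b : Fin (n - 1), atBond F.hPen b) *ᵥ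
        ∑ t ∈ Finset.range (m + 1), clockKet (γ t) (Φ t) = 0 := by
      rw [hpen]
      refine diagonal_mulVec_sum_clockKet_eq_zero fun t ht s => ?_
      rw [Finset.sum_eq_zero, zero_mul]
      exact fun b _ => if_neg (hγ.legal t (Finset.mem_range.1 ht) b)
    have z2 : F.chainIn n *ᵥ ∑ t ∈ Finset.range (m + 1), clockKet (γ t) (Φ t) = 0 := by
      rw [hin]
      refine diagonal_mulVec_sum_clockKet_eq_zero fun t ht s => ?_
      have ht := Finset.mem_range.1 ht
      by_cases hti : t < Tinit
      · have h1 : Φ t = f := by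
          simp only [Φ, χ, hγ.registerUnitary_eq_one hF t ht hti.le, one_mulVec, hg t hti, a]
          simp
        have h2 := congrFun (hinit t ht) s
        rw [hin, clockBlock_diagonal, Matrix.mulVec_diagonal] at h2
        rw [h1]
        exact h2
      · rw [Finset.sum_eq_zero, zero_mul]
        intro b _
        simp [hF.in_support _ _ hγ t ht (by omega) b]
    have z3 : F.chainOut n *ᵥ ∑ t ∈ Finset.range (m + 1), clockKet (γ t) (Φ t) = 0 := by
      rw [hout]
      refine diagonal_mulVec_sum_clockKet_eq_zero fun t ht s => ?_
      have ht := Finset.mem_range.1 ht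
      by_cases htm : t = m
      · subst htm
        have h1 : Φ t = U *ᵥ a := by simp [Φ, χ, hgm, hUm]
        rw [houtm, ← hP, h1, hPUa]; rfl
      · rw [Finset.sum_eq_zero, zero_mul]
        intro b _
        exact if_neg fun h => hlast t (by omega) b h.1
    rw [hamiltonian, add_mulVec, add_mulVec, add_mulVec, z1, z2, z3, add_zero, add_zero, add_zero]
    refine (hγ.hTrans_energy_le hd Φ).trans (le_of_eq ?_)
    rw [mul_left_comm, Finset.mul_sum _ _ r]
    congr 1
    refine Finset.sum_congr rfl fun t ht => ?_
    have ht := Finset.mem_range.1 ht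
    have h1 : F.stepGate (γ t) (γ (t + 1)) *ᵥ Φ t = F.registerUnitary γ (t + 1) *ᵥ χ t := by
      rw [mulVec_mulVec]; rfl
    rw [h1, hΦ _ (by omega), hΦ _ (by omega), isometry_dotProduct (hU _ (by omega)), hχ, hχ, hχ]
    ring

end StandardForm

/-! ### The damping profile -/

/-- For the standing wave `h j = cos ((j + 1/2) θ)`, the kinetic energy on `M` bonds is that of an
eigenvector with eigenvalue `1 - cos θ`, up to a boundary term. -/
theorem half_sum_sq_cos_sub (θ : ℝ) (M : ℕ) :
    1 / 2 * ∑ j ∈ Finset.range M,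
      (Real.cos (((j + 1 : ℕ) + 1 / 2) * θ) - Real.cos ((j + 1 / 2) * θ)) ^ 2 =
      (1 - Real.cos θ) * ∑ j ∈ Finset.range M, Real.cos ((j + 1 / 2) * θ) ^ 2 +
        1 / 2 * Real.cos ((M + 1 / 2) * θ) *
          (Real.cos ((M + 1 / 2) * θ) - Real.cos ((M - 1 / 2) * θ)) := by
  induction M with
  | zero =>
    have : ((0 : ℕ) - 1 / 2 : ℝ) * θ = -(((0 : ℕ) + 1 / 2 : ℝ) * θ) := by push_cast; ring
    rw [this, Real.cos_neg]
    simp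
  | succ M ih =>
    have h : Real.cos (((M + 1 : ℕ) + 1 / 2) * θ) + Real.cos ((M - 1 / 2) * θ) =
        2 * Real.cos θ * Real.cos ((M + 1 / 2) * θ) := by
      have e1 : ((M + 1 : ℕ) + 1 / 2 : ℝ) * θ = (M + 1 / 2) * θ + θ := by push_cast; ring
      have e2 : (M - 1 / 2 : ℝ) * θ = (M + 1 / 2) * θ - θ := by ring
      rw [e1, e2, Real.cos_add, Real.cos_sub]
      ring
    have e3 : ((M + 1 : ℕ) - 1 / 2 : ℝ) * θ = (M + 1 / 2) * θ := by push_cast; ring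
    rw [Finset.sum_range_succ, mul_add, ih, Finset.sum_range_succ, e3]
    linear_combination (-1 / 2) * Real.cos ((M + 1 / 2) * θ) * h

/-- A profile that is `1` before `Tinit`, vanishes at the last time step, and has at most the
kinetic energy per squared norm of the ground state of a path with `m + 1 - Tinit` vertices, one end
free and the other end bound. -/
theorem exists_profile {m Tinit : ℕ} (h : Tinit < m + 1) :
    ∃ g : ℕ → ℝ, (∀ t < Tinit, g t = 1) ∧ g m = 0 ∧ (∀ t ≤ m, g t ^ 2 ≤ 1) ∧
      1 / 2 * ∑ t ∈ Finset.range m, (g (t + 1) - g t) ^ 2 ≤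
        (1 - Real.cos (Real.pi / (2 * (((m + 1 : ℕ) : ℝ) - (Tinit : ℝ)) + 1))) *
          ∑ t ∈ Finset.range (m + 1), g t ^ 2 := by
  rcases Tinit with _ | k
  · exact ⟨fun _ => 0, by simp, rfl, by simp, by simp⟩
  obtain ⟨N, rfl⟩ := Nat.exists_eq_add_of_le (show k ≤ m by omega)
  have hden : 2 * (((k + N + 1 : ℕ) : ℝ) - ((k + 1 : ℕ) : ℝ)) + 1 = 2 * (N : ℝ) + 1 := by
    push_cast; ring
  rw [hden]
  set θ := Real.pi / (2 * (N : ℝ) + 1) with hθ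
  have hN : (0 : ℝ) < 2 * N + 1 := by positivity
  have hθpos : 0 < θ := div_pos Real.pi_pos hN
  have hNθ : (N + 1 / 2 : ℝ) * θ = Real.pi / 2 := by rw [hθ]; field_simp
  obtain ⟨f, hf⟩ : ∃ f : ℕ → ℝ, ∀ j, f j = Real.cos ((j + 1 / 2) * θ) := ⟨_, fun _ => rfl⟩
  have hN0 : 0 < N := by omega
  have hf0 : 0 < f 0 := by
    rw [hf]
    apply Real.cos_pos_of_mem_Ioo
    have : (1 : ℝ) ≤ N := by exact_mod_cast hN0
    constructor <;> push_cast <;> nlinarith [Real.pi_pos]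
  have hfN : f N = 0 := by rw [hf, hNθ, Real.cos_pi_div_two]
  have hfle : ∀ j ≤ N, 0 ≤ f j ∧ f j ≤ f 0 := by
    intro j hj
    have hj' : (j : ℝ) ≤ N := by exact_mod_cast hj
    have hjθ : (j + 1 / 2 : ℝ) * θ ≤ Real.pi / 2 := by
      rw [← hNθ]; gcongr
    have hj0 : (0 : ℝ) ≤ (j + 1 / 2 : ℝ) * θ := by positivity
    rw [hf, hf]
    refine ⟨Real.cos_nonneg_of_mem_Icc ⟨by linarith [Real.pi_pos], hjθ⟩, ?_⟩
    apply Real.cos_le_cos_of_nonneg_of_le_pi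
    · positivity
    · linarith [Real.pi_pos]
    · gcongr; simp
  have hwave : 1 / 2 * ∑ j ∈ Finset.range N, (f (j + 1) - f j) ^ 2 =
      (1 - Real.cos θ) * ∑ j ∈ Finset.range N, f j ^ 2 := by
    have := half_sum_sq_cos_sub θ N
    simp only [← hf] at this
    rw [this, hfN]
    ring
  -- Truncated subtraction makes the profile constant up to the time `k`.
  refine ⟨fun t => f (t - k) / f 0, ?_, ?_, ?_, ?_⟩
  · intro t ht
    have : t - k = 0 := by omega
    simp only [this]
    exact div_self hf0.ne'
  · simp [hfN]
  · intro t ht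
    obtain ⟨h1, h2⟩ := hfle (t - k) (by omega)
    have h3 : f (t - k) / f 0 ≤ 1 := (div_le_one hf0).2 h2
    have h4 : 0 ≤ f (t - k) / f 0 := div_nonneg h1 hf0.le
    exact pow_le_one₀ h4 h3
  · have h1 : ∑ t ∈ Finset.range (k + N), (f (t + 1 - k) / f 0 - f (t - k) / f 0) ^ 2 =
        (∑ j ∈ Finset.range N, (f (j + 1) - f j) ^ 2) / f 0 ^ 2 := by
      rw [Finset.sum_range_add, Finset.sum_eq_zero, zero_add, Finset.sum_div]
      · refine Finset.sum_congr rfl fun j _ => ?_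
        have e1 : k + j + 1 - k = j + 1 := by omega
        have e2 : k + j - k = j := by omega
        rw [e1, e2, ← sub_div, div_pow]
      · intro t ht
        have ht := Finset.mem_range.1 ht
        have e1 : t + 1 - k = 0 := by omega
        have e2 : t - k = 0 := by omega
        rw [e1, e2]
        simp
    have h2 : (∑ j ∈ Finset.range N, f j ^ 2) / f 0 ^ 2 ≤
        ∑ t ∈ Finset.range (k + N + 1), (f (t - k) / f 0) ^ 2 := by
      rw [Finset.sum_range_succ, Finset.sum_range_add, Finset.sum_div]
      have e : ∀ j, (f (k + j - k) / f 0) ^ 2 = f j ^ 2 / f 0 ^ 2 := fun j => by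
        rw [Nat.add_sub_cancel_left, div_pow]
      simp only [e]
      have : 0 ≤ ∑ t ∈ Finset.range k, (f (t - k) / f 0) ^ 2 :=
        Finset.sum_nonneg fun _ _ => sq_nonneg _
      have : 0 ≤ (f N / f 0) ^ 2 := sq_nonneg _
      have : 0 ≤ (f N) ^ 2 / f 0 ^ 2 := by positivity
      linarith
    rw [h1, ← mul_div_assoc, hwave, mul_div_assoc]
    exact mul_le_mul_of_nonneg_left h2 (by linarith [Real.cos_le_one θ])

/-! ### Rejection probabilities of a quantum Turing machine -/

namespace QTM

theorem HaltsAt.after_eq_zero {M : QTM} {ψ : M.Superposition} {τ τ' : ℕ} (h : M.HaltsAt ψ τ)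
    (h' : M.HaltsAt ψ τ') (hlt : τ < τ') : M.after τ ψ = 0 := by
  rw [← Finsupp.support_eq_empty, Finset.eq_empty_iff_forall_notMem]
  exact fun c hc => h'.2 τ hlt c hc (h.1 c hc)

theorem after_eq_zero_of_le {M : QTM} {ψ : M.Superposition} {τ τ' : ℕ} (h : M.after τ ψ = 0)
    (hle : τ ≤ τ') : M.after τ' ψ = 0 := by
  obtain ⟨d, rfl⟩ := Nat.exists_eq_add_of_le hle
  rw [after, add_comm, Function.iterate_add_apply]
  rw [after] at h
  rw [h]
  exact Function.iterate_fixed (map_zero _) d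

/-- Two halting times could differ only if the superposition vanished, and then all weights would
vanish. -/
theorem RejectsWithProb.unique {M : QTM} {x : List Bool} {k : ℕ}
    {w : EuclideanSpace ℂ (Fin k → Bool)} {r r' : ℝ} (h : M.RejectsWithProb x w r)
    (h' : M.RejectsWithProb x w r') : r = r' := by
  obtain ⟨τ, hτ, rfl⟩ := h
  obtain ⟨τ', hτ', rfl⟩ := h'
  rcases lt_trichotomy τ τ' with hlt | rfl | hlt
  · have h0 := hτ.after_eq_zero hτ' hlt
    rw [h0, after_eq_zero_of_le h0 hlt.le]
  · rfl
  · have h0 := hτ'.after_eq_zero hτ hlt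
    rw [h0, after_eq_zero_of_le h0 hlt.le]

end QTM

/-! ### The upper bound -/

/-- The constant is `π² / 2` for all `n` with `Tinit n ≤ T n / 2`, plus a crude bound for the
finitely many other ones. -/
theorem exists_one_sub_cos_le_div_sq {T Tinit : ℕ → ℕ}
    (hT : (fun n : ℕ => (n : ℝ) ^ 2) =O[atTop] fun n : ℕ => (T n : ℝ))
    (hTinit : (fun n : ℕ => (Tinit n : ℝ)) =O[atTop] fun n : ℕ => (n : ℝ)) :
    ∃ K : ℝ, ∀ n, Tinit n < T n →
      1 - Real.cos (Real.pi / (2 * ((T n : ℝ) - (Tinit n : ℝ)) + 1)) ≤ K / (T n : ℝ) ^ 2 := by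
  have hsq : (fun n : ℕ => (n : ℝ)) =o[atTop] fun n : ℕ => (n : ℝ) ^ 2 := by
    have h := (isLittleO_pow_pow_atTop_of_lt (𝕜 := ℝ) one_lt_two).comp_tendsto
      tendsto_natCast_atTop_atTop
    simpa [Function.comp_def] using h
  have ho : (fun n : ℕ => (Tinit n : ℝ)) =o[atTop] fun n : ℕ => (T n : ℝ) :=
    (hTinit.trans_isLittleO hsq).trans_isBigO hT
  obtain ⟨n₀, hn₀⟩ := eventually_atTop.1 (ho.def (show (0 : ℝ) < 1 / 2 by norm_num))
  refine ⟨Real.pi ^ 2 / 2 + ∑ n ∈ Finset.range n₀, 2 * (T n : ℝ) ^ 2, fun n hn => ?_⟩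
  have hTpos : (0 : ℝ) < T n := by exact_mod_cast (Nat.zero_le _).trans_lt hn
  have hsum : 0 ≤ ∑ n ∈ Finset.range n₀, 2 * (T n : ℝ) ^ 2 :=
    Finset.sum_nonneg fun _ _ => by positivity
  rw [le_div_iff₀ (by positivity)]
  by_cases h : n < n₀
  · have h1 : 2 * (T n : ℝ) ^ 2 ≤ ∑ n ∈ Finset.range n₀, 2 * (T n : ℝ) ^ 2 :=
      Finset.single_le_sum (f := fun n => 2 * (T n : ℝ) ^ 2) (fun _ _ => by positivity)
        (Finset.mem_range.2 h)
    have h2 := Real.neg_one_le_cos (Real.pi / (2 * ((T n : ℝ) - (Tinit n : ℝ)) + 1))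
    have h3 : 0 < Real.pi ^ 2 := by positivity
    nlinarith [sq_nonneg (T n : ℝ)]
  · have h1 := hn₀ n (not_lt.1 h)
    rw [Real.norm_of_nonneg (by positivity), Real.norm_of_nonneg (by positivity)] at h1
    have hden : (T n : ℝ) ≤ 2 * ((T n : ℝ) - (Tinit n : ℝ)) + 1 := by linarith
    have h2 := Real.one_sub_sq_div_two_le_cos
      (x := Real.pi / (2 * ((T n : ℝ) - (Tinit n : ℝ)) + 1))
    have h3 : Real.pi / (2 * ((T n : ℝ) - (Tinit n : ℝ)) + 1) ≤ Real.pi / T n :=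
      div_le_div_of_nonneg_left Real.pi_pos.le hTpos hden
    have h4 : 0 ≤ Real.pi / (2 * ((T n : ℝ) - (Tinit n : ℝ)) + 1) :=
      div_nonneg Real.pi_pos.le (by linarith)
    have h5 : (Real.pi / (2 * ((T n : ℝ) - (Tinit n : ℝ)) + 1)) ^ 2 ≤ (Real.pi / T n) ^ 2 :=
      pow_le_pow_left₀ h4 h3 2
    have h6 : (Real.pi / T n) ^ 2 * (T n : ℝ) ^ 2 = Real.pi ^ 2 := by
      rw [div_pow, div_mul_cancel₀]; positivity
    nlinarith [sq_nonneg (T n : ℝ), mul_le_mul_of_nonneg_right h5 (sq_nonneg (T n : ℝ))]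

open Matrix in
/-- The Rayleigh quotient of the history state with the profile of `exists_profile`. -/
theorem StandardForm.groundEnergy_le {C Q n m Tinit R : ℕ} {F : StandardForm C Q}
    (hF : F.IsStandardFormClock n (m + 1) Tinit R) {γ : ℕ → Fin n → Fin C}
    (hγ : F.IsEvolution (m + 1) γ) {φ : EuclideanSpace ℂ (Fin n → Fin Q)} (hφ : ‖φ‖ = 1)
    (hinit : F.Initialised (m + 1) γ φ) (hr : F.rejectionProb (m + 1) γ φ < 1)
    [Nonempty (ChainBasis n C Q)] :
    groundEnergy (F.hamiltonian n) ≤ F.rejectionProb (m + 1) γ φ *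
      (1 - Real.cos (Real.pi / (2 * (((m + 1 : ℕ) : ℝ) - (Tinit : ℝ)) + 1))) := by
  obtain ⟨g, hg, hgm, hg1, hE⟩ := exists_profile hF.init_lt
  obtain ⟨hr0, ψ, hnorm, henergy⟩ := exists_historyState hF hγ hφ hinit g hg hgm
  set r := F.rejectionProb (m + 1) γ φ
  set ε := 1 - Real.cos (Real.pi / (2 * (((m + 1 : ℕ) : ℝ) - (Tinit : ℝ)) + 1))
  have hε : 0 ≤ ε := sub_nonneg.2 (Real.cos_le_one _)
  have hpos : 0 < (star ψ ⬝ᵥ ψ).re := by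
    rw [hnorm]
    refine Finset.sum_pos (fun t _ => ?_) (by simp)
    have := mul_nonneg hr0 (sq_nonneg (g t))
    linarith
  have hle : ∑ t ∈ Finset.range (m + 1), g t ^ 2 ≤ (star ψ ⬝ᵥ ψ).re := by
    rw [hnorm]
    refine Finset.sum_le_sum fun t ht => ?_
    have := hg1 t (Nat.lt_succ_iff.1 (Finset.mem_range.1 ht))
    nlinarith
  refine le_of_mul_le_mul_right ?_ hpos
  calc groundEnergy (F.hamiltonian n) * (star ψ ⬝ᵥ ψ).re
      ≤ (star ψ ⬝ᵥ F.hamiltonian n *ᵥ ψ).re :=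
        groundEnergy_mul_le (F.hamiltonian_posSemidef n).1 ψ
    _ ≤ r * (1 / 2 * ∑ t ∈ Finset.range m, (g (t + 1) - g t) ^ 2) := henergy
    _ ≤ r * (ε * (star ψ ⬝ᵥ ψ).re) :=
        mul_le_mul_of_nonneg_left (hE.trans (mul_le_mul_of_nonneg_left hle hε)) hr0
    _ = r * ε * (star ψ ⬝ᵥ ψ).re := by ring

theorem mainTheorem2 (T Tinit R : ℕ → ℕ)
    (hT : (fun n : ℕ => (n : ℝ) ^ 2) =O[atTop] fun n : ℕ => (T n : ℝ))
    (hTinit : (fun n : ℕ => (Tinit n : ℝ)) =O[atTop] fun n : ℕ => (n : ℝ))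
    (hR : (fun n : ℕ => (R n : ℝ)) =O[atTop] fun n : ℕ => (n : ℝ)) :
    ∃ K : ℝ, ∀ (η s : ℝ), 0 ≤ η → 0 ≤ s → s < 1 - η →
      ∀ (A : PromiseProblem) (M : QTM) (p q : Polynomial ℕ), IsQMAVerifier A M p q η s →
      ∀ x ∈ A.yes, ∀ (n C Q : ℕ) (F : StandardForm C Q),
        F.IsStandardFormClock n (T n) (Tinit n) (R n) →
        F.EncodesVerification n (T n) M x (q.eval x.length) →
          IsLeast (energies (F.hamiltonian n)) (groundEnergy (F.hamiltonian n)) ∧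
          0 ≤ groundEnergy (F.hamiltonian n) ∧
          groundEnergy (F.hamiltonian n) ≤
            η * (1 - Real.cos (Real.pi / (2 * ((T n : ℝ) - (Tinit n : ℝ)) + 1))) ∧
          η * (1 - Real.cos (Real.pi / (2 * ((T n : ℝ) - (Tinit n : ℝ)) + 1))) ≤
            K * (η / (T n : ℝ) ^ 2) := by
  obtain ⟨K, hK⟩ := exists_one_sub_cos_le_div_sq hT hTinit
  refine ⟨K, fun η s hη hs hsη A M p q hV x hx n C Q F hF hEnc => ?_⟩
  obtain ⟨γ, hγ, hE, -⟩ := hEnc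
  obtain ⟨k, hk, w, hw, r, hrη, hr⟩ := hV.complete x hx
  obtain ⟨E, hE⟩ := hE k hk
  obtain ⟨hinit, hrej⟩ := hE w hw
  obtain rfl := hr.unique hrej
  have hφ : ‖E w‖ = 1 := by rw [E.norm_map, hw]
  -- A register without basis states has no unit vectors.
  have : Nonempty (Fin n → Fin Q) := by
    by_contra h
    rw [not_nonempty_iff] at h
    have h0 : E w = 0 := Subsingleton.elim _ _
    rw [h0, norm_zero] at hφ
    exact zero_ne_one hφ
  have : Nonempty (ChainBasis n C Q) := ⟨(γ 0, Classical.arbitrary _)⟩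
  have hpsd := F.hamiltonian_posSemidef n
  have hε : 0 ≤ 1 - Real.cos (Real.pi / (2 * ((T n : ℝ) - (Tinit n : ℝ)) + 1)) :=
    sub_nonneg.2 (Real.cos_le_one _)
  refine ⟨energies_isLeast hpsd.1, groundEnergy_nonneg hpsd, ?_, ?_⟩
  · obtain ⟨m, hm⟩ : ∃ m, T n = m + 1 := ⟨T n - 1, by have := hF.init_lt; omega⟩
    rw [hm] at hF hγ hinit hrη hε ⊢
    exact (F.groundEnergy_le hF hγ hφ hinit (by linarith)).trans
      (mul_le_mul_of_nonneg_right hrη hε)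
  · calc _ ≤ η * (K / (T n : ℝ) ^ 2) := mul_le_mul_of_nonneg_left (hK n hF.init_lt) hη
      _ = _ := by ring
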